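/- Let $F$ be an imaginary quadratic field with ring of integers $\mathcal O_F$, embedded in $\mathbb C$, let $p$ be a rational prime, $\mathfrak p$ a prime of $F$ above $p$, $\mathfrak m\subset\mathcal O_F$ an ideal coprime to $\mathfrak p$, and $k\ge 0$ an integer. Write $\mathbb A_F=\mathbb C\times\mathbb A_F^f$ and $\mathrm{PGL}_2^f(\mathbb A_F)=\mathrm{GL}_2(\mathbb C)\times\mathrm{PGL}_2(\mathbb A_F^f)$, and let $V=V_{2k+2}(\mathbb C)$ be the space of homogeneous polynomials of degree $2k+2$ in two variables, with $\mathrm{SU}_2(\mathbb C)$ acting on the right by linear substitution, $(P|u)(X,Y)=P(aX+bY,cX+dY)$ for $u=\begin{pmatrix}a&b\\c&d\end{pmatrix}$. *Cusp forms.* A cusp form of weight $(k,k)$ and level a subgroup $U\subset\mathrm{GL}_2(\mathbb A_F^f)$ is a function $f:\mathrm{GL}_2(\mathbb A_F)\to V$ such that (i) $f(zgu)=f(g)|u$ for $u\in\mathrm{SU}_2(\mathbb C)$ and $z\in Z(\mathrm{GL}_2(\mathbb C))$; (ii) $f$ is right invariant under $U$; (iii) $f$ is left invariant under $\mathrm{GL}_2(F)$;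 (iv) $f$ is smooth in the variable of $\mathrm{GL}_2(\mathbb C)$ and, for both simple components of $\mathfrak{sl}_2(\mathbb C)\otimes_{\mathbb R}\mathbb C$, an eigenfunction with eigenvalue $k^2/2+k$ of $\partial=H^2/2+XY+YX$, where $\partial/4$ is that component of the Casimir operator; (v) for all $g$, $\int_{F\backslash\mathbb A_F}f\left(\begin{pmatrix}1&u\\0&1\end{pmatrix}g\right)du=0$, the integrand being integrable. A cusp form on $\mathrm{PGL}_2^f(\mathbb A_F)$ of level $U$ is a function on $\mathrm{PGL}_2^f(\mathbb A_F)$ whose pullback to $\mathrm{GL}_2(\mathbb A_F)$ is a cusp form of level $U$; for a subgroup of $\mathrm{PGL}_2(\mathbb A_F^f)$, level means its preimage in $\mathrm{GL}_2(\mathbb A_F^f)$. For an ideal $\mathfrak n$ let $\Omega_0(\mathfrak n)\subset\mathrm{GL}_2(\widehat{\mathcal O}_F)$ be the subgroup of matrices with lower left entry in $\mathfrak n\widehat{\mathcal O}_F$, and let $S_{k,k}(\Omega_0(\mathfrak n))$ be the space of cusp forms on $\mathrm{PGL}_2^f(\mathbb A_F)$ of weight $(k,k)$ and level $\Omega_0(\mathfrak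 n)$. *The tree.* Let $\mathcal T_{\mathfrak p}$ be the Bruhat–Tits tree of $\mathrm{GL}_2(F_{\mathfrak p})$, with vertices the homothety classes of $\mathcal O_{\mathfrak p}$-lattices in $F_{\mathfrak p}^2$ (column vectors), $\mathcal E(\mathcal T_{\mathfrak p})$ its set of oriented edges, $s(e),t(e),\bar e$ the source, target and reverse of $e$, and $e_*$ the edge from $[\mathcal O_{\mathfrak p}\oplus\mathcal O_{\mathfrak p}]$ to $[\mathcal O_{\mathfrak p}\oplus\mathfrak p\mathcal O_{\mathfrak p}]$. Let $\widetilde\Omega\subset\mathrm{PGL}_2(\mathbb A_F^f)$ be the image of the group of $\gamma\in\mathrm{GL}_2(\mathbb A_F^f)$ such that for all $v\ne\mathfrak p$, $\gamma_v\in\mathrm{GL}_2(\mathcal O_v)$ has lower left entry in $\mathfrak m\mathcal O_v$, and let $\Omega\subset\widetilde\Omega$ be the subgroup of classes whose determinant has even valuation at all primes above $p$. It acts on $\mathcal T_{\mathfrak p}$ on the left through the component at $\mathfrak p$. Let $\mathbb S_{k,k}(\Omega,\mathcal T_{\mathfrak p})$ be the space of functions $\mathcal F:\mathcal E(\mathcal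 T_{\mathfrak p})\times\mathrm{PGL}_2^f(\mathbb A_F)\to V$ such that 1. $\mathcal F(\gamma e,g\gamma^{-1})=\mathcal F(e,g)$ for all $\gamma\in\Omega$; 2. $\mathcal F$ is harmonic in $e$: $\mathcal F(\bar e,g)=-\mathcal F(e,g)$, and $\sum_{s(e)=v}\mathcal F(e,g)=\sum_{t(e)=v}\mathcal F(e,g)=0$ for every vertex $v$; 3. for every edge $e$, $\mathcal F_e=\mathcal F(e,\cdot)$ is a cusp form on $\mathrm{PGL}_2^f(\mathbb A_F)$ of weight $(k,k)$ and level $\mathrm{Stab}_\Omega(e)$. *New forms.* Write $\Omega_0(\mathfrak m)=\coprod_i\gamma_i\Omega_0(\mathfrak p\mathfrak m)$ and let $\alpha\in\mathrm{GL}_2(F_{\mathfrak p})\subset\mathrm{GL}_2(\mathbb A_F^f)$ be such that $\alpha e_*=\overline{e_*}$. Let $S_{k,k}(\Omega_0(\mathfrak p\mathfrak m))^{\mathfrak p\text{-new}}$ be the space of $f\in S_{k,k}(\Omega_0(\mathfrak p\mathfrak m))$ with $\sum_i f(g\gamma_i)=0$ and $\sum_i f(g\gamma_i\alpha)=0$ for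 all $g$. **Theorem.** The map $\mathcal F\mapsto\mathcal F_{e_*}$ is an isomorphism of complex vector spaces $$\mathbb S_{k,k}(\Omega,\mathcal T_{\mathfrak p})\;\cong\;S_{k,k}(\Omega_0(\mathfrak p\mathfrak m))^{\mathfrak p\text{-new}}.$$ In particular, $f\in S_{k,k}(\Omega_0(\mathfrak p\mathfrak m))$ is of the form $\mathcal F_{e_*}$ for some $\mathcal F\in\mathbb S_{k,k}(\Omega,\mathcal T_{\mathfrak p})$ if and only if $f$ is $\mathfrak p$-new. Moreover, if $F$ has class number $1$, every cusp form of weight $(k,k)$ and level $\Omega_0(\mathfrak p\mathfrak m)$ on $\mathrm{GL}_2(\mathbb A_F)$ is the pullback of one on $\mathrm{PGL}_2^f(\mathbb A_F)$, so $S_{k,k}(\Omega_0(\mathfrak p\mathfrak m))$ is then the full space of such forms. -/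

import Mathlib

namespace BianchiTree

open IsDedekindDomain NumberField MeasureTheory Matrix

noncomputable section

/-! ### Adelic groups -/

section Adelic

variable (F : Type*) [Field F] [NumberField F]

/-- The ring of finite adeles of `F`. -/
abbrev FinAdeles := FiniteAdeleRing (𝓞 F) F

/-- `GL₂(𝔸_F^f)`. -/
abbrev GL2Fin := GL (Fin 2) (FinAdeles F)

/-- `GL₂(𝔸_F) = GL₂(ℂ) × GL₂(𝔸_F^f)`, for `F` imaginary quadratic. -/
abbrev GL2Adele := GL (Fin 2) ℂ × GL2Fin F

/-- `PGL₂(𝔸_F^f)`. -/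
abbrev PGL2Fin := GL2Fin F ⧸ Subgroup.center (GL2Fin F)

/-- `PGL₂^f(𝔸_F) = GL₂(ℂ) × PGL₂(𝔸_F^f)`. -/
abbrev PGL2f := GL (Fin 2) ℂ × PGL2Fin F

variable {F}

/-- The projection `GL₂(𝔸_F^f) → PGL₂(𝔸_F^f)`. -/
def toPGL : GL2Fin F →* PGL2Fin F := QuotientGroup.mk' _

/-- The projection of the finite adeles to the completion at `v`. -/
def localComp (v : HeightOneSpectrum (𝓞 F)) : FinAdeles F →+* v.adicCompletion F where
  toFun a := a v
  map_one' := rfl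
  map_mul' _ _ := rfl
  map_zero' := rfl
  map_add' _ _ := rfl

/-- The projection `GL₂(𝔸_F^f) → GL₂(F_v)`. -/
def localGL (v : HeightOneSpectrum (𝓞 F)) : GL2Fin F →* GL (Fin 2) (v.adicCompletion F) :=
  GeneralLinearGroup.map (localComp v)

/-- `R₀(𝔫)_v`: the integral matrices over `𝒪_v` whose lower left entry lies in `𝔫 𝒪_v`. -/
def localOrder (𝔫 : Ideal (𝓞 F)) (v : HeightOneSpectrum (𝓞 F)) :
    Submonoid (Matrix (Fin 2) (Fin 2) (v.adicCompletion F)) where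
  carrier := {M | (∀ i j, M i j ∈ v.adicCompletionIntegers F) ∧
    ∃ c ∈ 𝔫.map (algebraMap (𝓞 F) (v.adicCompletionIntegers F)),
      (c : v.adicCompletion F) = M 1 0}
  one_mem' := by
    refine ⟨fun i j => ?_, 0, Ideal.zero_mem _, by simp⟩
    by_cases h : i = j
    · subst h; simp
    · simp [Matrix.one_apply_ne h]
  mul_mem' := by
    rintro A B ⟨hA, a, ha, hac⟩ ⟨hB, b, hb, hbc⟩
    refine ⟨fun i j => ?_, a * ⟨B 0 0, hB 0 0⟩ + ⟨A 1 1, hA 1 1⟩ * b,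
      Ideal.add_mem _ (Ideal.mul_mem_right _ _ ha) (Ideal.mul_mem_left _ _ hb), ?_⟩
    · rw [Matrix.mul_apply]
      exact sum_mem fun x _ => mul_mem (hA i x) (hB x j)
    · simp [Matrix.mul_apply, hac, hbc]

/-- The elements `γ ∈ GL₂(𝔸_F^f)` with `γ_v ∈ R₀(𝔫)_v^×` for all places `v ∈ S`. -/
def localUnits (𝔫 : Ideal (𝓞 F)) (S : Set (HeightOneSpectrum (𝓞 F))) : Subgroup (GL2Fin F) where
  carrier := {γ | ∀ v ∈ S, (localGL v γ).1 ∈ localOrder 𝔫 v ∧ (localGL v γ⁻¹).1 ∈ localOrder 𝔫 v}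
  one_mem' := fun v _ => by simp [one_mem]
  mul_mem' := by
    intro a b ha hb v hv
    rw [_root_.mul_inv_rev, map_mul, map_mul, Units.val_mul, Units.val_mul]
    exact ⟨mul_mem (ha v hv).1 (hb v hv).1, mul_mem (hb v hv).2 (ha v hv).2⟩
  inv_mem' := by
    intro a ha v hv
    rw [inv_inv]
    exact ⟨(ha v hv).2, (ha v hv).1⟩

/-- `Ω₀(𝔫)`: matrices in `GL₂(𝒪̂_F)` with lower left entry in `𝔫 𝒪̂_F`. -/
def Omega0 (𝔫 : Ideal (𝓞 F)) : Subgroup (GL2Fin F) := localUnits 𝔫 Set.univ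

/-- `Ω̃`: the image in `PGL₂(𝔸_F^f)` of `R₀(𝔪)^×`, where there is no condition at `𝔭`. -/
def OmegaTilde (𝔭 : HeightOneSpectrum (𝓞 F)) (𝔪 : Ideal (𝓞 F)) : Subgroup (PGL2Fin F) :=
  (localUnits 𝔪 {v | v ≠ 𝔭}).map toPGL

/-- The elements of `GL₂(𝔸_F^f)` whose determinant has even valuation at every prime above `p`
(the valuation is written multiplicatively, so that even means square). -/
def GLPlus (p : ℕ) : Subgroup (GL2Fin F) where
  carrier := {γ | ∀ v : HeightOneSpectrum (𝓞 F), (p : 𝓞 F) ∈ v.asIdeal →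
    IsSquare (Valued.v (localGL v γ).1.det)}
  one_mem' := fun v _ => by simp
  mul_mem' := by
    intro a b ha hb v hv
    rw [map_mul, Units.val_mul, Matrix.det_mul, map_mul]
    exact (ha v hv).mul (hb v hv)
  inv_mem' := by
    intro a ha v hv
    have h : Valued.v (localGL v a⁻¹).1.det = (Valued.v (localGL v a).1.det)⁻¹ := by
      refine eq_inv_of_mul_eq_one_left ?_
      rw [← map_mul, ← Matrix.det_mul, ← Units.val_mul, ← map_mul]
      simp
    rw [h]
    exact (ha v hv).inv

/-- `PGL₂⁺(𝔸_F^f)`. -/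
def PGLPlus (p : ℕ) : Subgroup (PGL2Fin F) := (GLPlus p).map toPGL

/-- `Ω = PGL₂⁺(𝔸_F^f) ∩ Ω̃`. -/
def Omega (p : ℕ) (𝔭 : HeightOneSpectrum (𝓞 F)) (𝔪 : Ideal (𝓞 F)) : Subgroup (PGL2Fin F) :=
  PGLPlus p ⊓ OmegaTilde 𝔭 𝔪

end Adelic

/-! ### Bianchi cusp forms -/

section CuspForms

/-- The space `V_{2k+2}(ℂ)` of homogeneous polynomials of degree `2k+2` in two variables. -/
abbrev WeightSpace (k : ℕ) : Submodule ℂ (MvPolynomial (Fin 2) ℂ) :=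
  MvPolynomial.homogeneousSubmodule (Fin 2) ℂ (2 * k + 2)

/-- The right action of matrices on polynomials by linear substitution,
`(P|u)(X, Y) = P(aX + bY, cX + dY)`. -/
def subst (u : Matrix (Fin 2) (Fin 2) ℂ) (P : MvPolynomial (Fin 2) ℂ) : MvPolynomial (Fin 2) ℂ :=
  MvPolynomial.bind₁ (fun i => ∑ j, MvPolynomial.C (u i j) * MvPolynomial.X j) P

/-- The open subset `GL₂(ℂ)` of the real vector space `M₂(ℂ)`. -/
def invertibles : Set (Fin 2 → Fin 2 → ℂ) := {A | (Matrix.of A).det ≠ 0}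

/-- Extension by zero of a function on `GL₂(ℂ)` to `M₂(ℂ)`. -/
def extendZero (φ : GL (Fin 2) ℂ → ℂ) : (Fin 2 → Fin 2 → ℂ) → ℂ := fun A =>
  open Classical in
  if h : (Matrix.of A).det ≠ 0 then φ (GeneralLinearGroup.mkOfDetNeZero (Matrix.of A) h) else 0

/-- The left invariant vector field of `X ∈ 𝔤𝔩₂(ℂ)`: on `GL₂(ℂ)`,
`(Xφ)(A) = d/dt φ(A exp(tX))` at `t = 0`, with `t` real. -/
def lieDeriv (X : Matrix (Fin 2) (Fin 2) ℂ) (φ : (Fin 2 → Fin 2 → ℂ) → ℂ) :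
    (Fin 2 → Fin 2 → ℂ) → ℂ :=
  fun A => fderiv ℝ φ A (fun i j => (Matrix.of A * X) i j)

/-- For `c = i` and `c = -i`, the images of `X ∈ 𝔰𝔩₂(ℂ)` in the two simple components of
`𝔰𝔩₂(ℂ) ⊗_ℝ ℂ ≅ 𝔰𝔩₂(ℂ) ⊕ 𝔰𝔩₂(ℂ)`, acting on functions by left invariant vector fields. -/
def componentDeriv (c : ℂ) (X : Matrix (Fin 2) (Fin 2) ℂ) (φ : (Fin 2 → Fin 2 → ℂ) → ℂ) :
    (Fin 2 → Fin 2 → ℂ) → ℂ :=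
  fun A => (1 / 2) * (lieDeriv X φ A - c * lieDeriv (Complex.I • X) φ A)

/-- The operator `∂ = H²/2 + XY + YX` of one component of `𝔰𝔩₂(ℂ) ⊗_ℝ ℂ`; `∂/4` is the
corresponding component of the Casimir operator. -/
def casimir (c : ℂ) (φ : (Fin 2 → Fin 2 → ℂ) → ℂ) : (Fin 2 → Fin 2 → ℂ) → ℂ :=
  fun A =>
    (1 / 2) * componentDeriv c !![1, 0; 0, -1] (componentDeriv c !![1, 0; 0, -1] φ) A
    + componentDeriv c !![0, 1; 0, 0] (componentDeriv c !![0, 0; 1, 0] φ) A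
    + componentDeriv c !![0, 0; 1, 0] (componentDeriv c !![0, 1; 0, 0] φ) A

/-- The unipotent matrix with upper right entry `x`. -/
def unipotent {R : Type*} [CommRing R] (x : R) : GL (Fin 2) R :=
  ⟨!![1, x; 0, 1], !![1, -x; 0, 1], by simp [Matrix.one_fin_two], by simp [Matrix.one_fin_two]⟩

variable {F : Type*} [Field F] [NumberField F]

/-- `F` embedded diagonally in `𝔸_F = ℂ × 𝔸_F^f`. -/
def principalAdeles (σ : F →+* ℂ) : AddSubgroup (ℂ × FinAdeles F) :=
  (σ.prod (algebraMap F (FinAdeles F))).toAddMonoidHom.range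

/-- `F \ 𝔸_F`. -/
abbrev AdeleQuotient (σ : F →+* ℂ) := (ℂ × FinAdeles F) ⧸ principalAdeles σ

instance (σ : F →+* ℂ) : MeasurableSpace (AdeleQuotient σ) := borel _

instance (σ : F →+* ℂ) : BorelSpace (AdeleQuotient σ) := ⟨rfl⟩

/-- Cusp forms of weight `(k,k)` and level `U ⊆ GL₂(𝔸_F^f)`. -/
structure IsCuspForm (σ : F →+* ℂ) (k : ℕ) (U : Subgroup (GL2Fin F))
    (f : GL2Adele F → WeightSpace k) : Prop where
  weight : ∀ (g : GL2Adele F) (z : ℂˣ) (u : GL (Fin 2) ℂ),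
    u.1 ∈ Matrix.specialUnitaryGroup (Fin 2) ℂ →
      (f (GeneralLinearGroup.scalar (Fin 2) z * g.1 * u, g.2)).1 = subst u.1 (f g).1
  level : ∀ (g : GL2Adele F), ∀ u ∈ U, f (g.1, g.2 * u) = f g
  automorphic : ∀ (γ : GL (Fin 2) F) (g : GL2Adele F),
    f (GeneralLinearGroup.map σ γ * g.1,
      GeneralLinearGroup.map (algebraMap F (FinAdeles F)) γ * g.2) = f g
  smooth : ∀ (h : GL2Fin F) (d : Fin 2 →₀ ℕ),
    ContDiffOn ℝ (⊤ : ℕ∞) (extendZero fun x => (f (x, h)).1.coeff d) invertibles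
  eigen : ∀ c : ℂ, c = Complex.I ∨ c = -Complex.I →
    ∀ (h : GL2Fin F) (d : Fin 2 →₀ ℕ), ∀ A ∈ invertibles,
      casimir c (extendZero fun x => (f (x, h)).1.coeff d) A
        = ((k : ℂ) ^ 2 / 2 + k) * extendZero (fun x => (f (x, h)).1.coeff d) A
  cuspidal : ∀ μ : Measure (AdeleQuotient σ), μ.IsAddHaarMeasure →
    ∀ (g : GL2Adele F) (d : Fin 2 →₀ ℕ),
      Integrable (fun x : AdeleQuotient σ =>
        (f (unipotent x.out.1 * g.1, unipotent x.out.2 * g.2)).1.coeff d) μ ∧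
      ∫ x : AdeleQuotient σ,
        (f (unipotent x.out.1 * g.1, unipotent x.out.2 * g.2)).1.coeff d ∂μ = 0


theorem isOpen_invertibles : IsOpen invertibles := by
  have h : Continuous fun A : Fin 2 → Fin 2 → ℂ => (Matrix.of A).det := by
    simp only [Matrix.det_fin_two, Matrix.of_apply]
    fun_prop
  exact isOpen_ne_fun h continuous_const

theorem lieDeriv_contDiffOn {φ : (Fin 2 → Fin 2 → ℂ) → ℂ}
    (hφ : ContDiffOn ℝ (⊤ : ℕ∞) φ invertibles) (X : Matrix (Fin 2) (Fin 2) ℂ) :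
    ContDiffOn ℝ (⊤ : ℕ∞) (lieDeriv X φ) invertibles := by
  have h1 : ContDiffOn ℝ (⊤ : ℕ∞) (fderiv ℝ φ) invertibles :=
    hφ.fderiv_of_isOpen isOpen_invertibles (by simp)
  refine h1.clm_apply (ContDiff.contDiffOn ?_)
  simp only [Matrix.mul_apply, Matrix.of_apply]
  fun_prop

theorem lieDeriv_linear {φ ψ χ : (Fin 2 → Fin 2 → ℂ) → ℂ} (a : ℂ)
    (hφ : ContDiffOn ℝ (⊤ : ℕ∞) φ invertibles) (hψ : ContDiffOn ℝ (⊤ : ℕ∞) ψ invertibles)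
    (h : Set.EqOn χ (a • φ + ψ) invertibles) (X : Matrix (Fin 2) (Fin 2) ℂ) :
    Set.EqOn (lieDeriv X χ) (a • lieDeriv X φ + lieDeriv X ψ) invertibles := by
  intro A hA
  have hn := isOpen_invertibles.mem_nhds hA
  have d1 : DifferentiableAt ℝ φ A := (hφ.contDiffAt hn).differentiableAt (by simp)
  have d2 : DifferentiableAt ℝ ψ A := (hψ.contDiffAt hn).differentiableAt (by simp)
  have e : χ =ᶠ[nhds A] a • φ + ψ := Filter.eventuallyEq_of_mem hn h
  simp only [lieDeriv, Pi.add_apply, Pi.smul_apply]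
  rw [e.fderiv_eq, fderiv_add (d1.const_smul a) d2, fderiv_const_smul d1]
  rfl

theorem componentDeriv_contDiffOn {φ : (Fin 2 → Fin 2 → ℂ) → ℂ}
    (hφ : ContDiffOn ℝ (⊤ : ℕ∞) φ invertibles) (c : ℂ) (X : Matrix (Fin 2) (Fin 2) ℂ) :
    ContDiffOn ℝ (⊤ : ℕ∞) (componentDeriv c X φ) invertibles :=
  contDiffOn_const.mul ((lieDeriv_contDiffOn hφ X).sub
    (contDiffOn_const.mul (lieDeriv_contDiffOn hφ _)))

theorem componentDeriv_linear {φ ψ χ : (Fin 2 → Fin 2 → ℂ) → ℂ} (a : ℂ)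
    (hφ : ContDiffOn ℝ (⊤ : ℕ∞) φ invertibles) (hψ : ContDiffOn ℝ (⊤ : ℕ∞) ψ invertibles)
    (h : Set.EqOn χ (a • φ + ψ) invertibles) (c : ℂ) (X : Matrix (Fin 2) (Fin 2) ℂ) :
    Set.EqOn (componentDeriv c X χ) (a • componentDeriv c X φ + componentDeriv c X ψ)
      invertibles := by
  intro A hA
  have h1 := lieDeriv_linear a hφ hψ h X hA
  have h2 := lieDeriv_linear a hφ hψ h (Complex.I • X) hA
  simp only [componentDeriv, Pi.add_apply, Pi.smul_apply, smul_eq_mul] at *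
  rw [h1, h2]
  ring

theorem casimir_linear {φ ψ χ : (Fin 2 → Fin 2 → ℂ) → ℂ} (a : ℂ)
    (hφ : ContDiffOn ℝ (⊤ : ℕ∞) φ invertibles) (hψ : ContDiffOn ℝ (⊤ : ℕ∞) ψ invertibles)
    (h : Set.EqOn χ (a • φ + ψ) invertibles) (c : ℂ) :
    Set.EqOn (casimir c χ) (a • casimir c φ + casimir c ψ) invertibles := by
  intro A hA
  have key := fun X Y : Matrix (Fin 2) (Fin 2) ℂ =>
    componentDeriv_linear a (componentDeriv_contDiffOn hφ c Y) (componentDeriv_contDiffOn hψ c Y)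
      (componentDeriv_linear a hφ hψ h c Y) c X hA
  simp only [casimir, Pi.add_apply, Pi.smul_apply, smul_eq_mul] at *
  rw [key, key, key]
  ring

theorem extendZero_linear (a : ℂ) (φ ψ : GL (Fin 2) ℂ → ℂ) :
    extendZero (fun x => a * φ x + ψ x) = a • extendZero φ + extendZero ψ := by
  funext A
  by_cases h : (Matrix.of A).det ≠ 0 <;> simp [extendZero, h]

theorem extendZero_zero : extendZero (fun _ => 0) = 0 := by
  funext A
  simp [extendZero]

theorem IsCuspForm.zero (σ : F →+* ℂ) (k : ℕ) (U : Subgroup (GL2Fin F)) :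
    IsCuspForm σ k U 0 where
  weight := by intros; simp [subst]
  level := by intros; rfl
  automorphic := by intros; rfl
  smooth := by
    intro h d
    simp only [Pi.zero_apply, ZeroMemClass.coe_zero, MvPolynomial.coeff_zero, extendZero_zero]
    exact contDiffOn_const
  eigen := by
    intro c _ h d A _
    have h0 : ∀ X, lieDeriv X 0 = 0 := by
      intro X; funext A; simp [lieDeriv]
    have h1 : ∀ X, componentDeriv c X 0 = 0 := by
      intro X; funext A; simp [componentDeriv, h0]
    simp only [Pi.zero_apply, ZeroMemClass.coe_zero, MvPolynomial.coeff_zero, extendZero_zero]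
    simp [casimir, h1]
  cuspidal := by intros; simp

theorem IsCuspForm.linear {σ : F →+* ℂ} {k : ℕ} {U : Subgroup (GL2Fin F)}
    {f f' : GL2Adele F → WeightSpace k} (hf : IsCuspForm σ k U f) (hf' : IsCuspForm σ k U f')
    (a : ℂ) : IsCuspForm σ k U (a • f + f') := by
  have key : ∀ (h : GL2Fin F) (d : Fin 2 →₀ ℕ),
      (extendZero fun x => ((a • f + f') (x, h)).1.coeff d)
        = a • (extendZero fun x => (f (x, h)).1.coeff d)
          + extendZero fun x => (f' (x, h)).1.coeff d := by
    intro h d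
    rw [← extendZero_linear]
    simp
  refine ⟨?_, ?_, ?_, ?_, ?_, ?_⟩
  · intro g z u hu
    have h1 := hf.weight g z u hu
    have h2 := hf'.weight g z u hu
    simp only [Pi.add_apply, Pi.smul_apply, Submodule.coe_add, Submodule.coe_smul, h1, h2, subst,
      map_add, map_smul]
  · intro g u hu
    simp [hf.level g u hu, hf'.level g u hu]
  · intro γ g
    simp [hf.automorphic γ g, hf'.automorphic γ g]
  · intro h d
    rw [key]
    exact ((hf.smooth h d).const_smul a).add (hf'.smooth h d)
  · intro c hc h d A hA
    rw [key, casimir_linear a (hf.smooth h d) (hf'.smooth h d) (fun _ _ => rfl) c hA]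
    simp only [Pi.add_apply, Pi.smul_apply, smul_eq_mul]
    rw [hf.eigen c hc h d A hA, hf'.eigen c hc h d A hA]
    ring
  · intro μ hμ g d
    obtain ⟨i1, z1⟩ := hf.cuspidal μ hμ g d
    obtain ⟨i2, z2⟩ := hf'.cuspidal μ hμ g d
    simp only [Pi.add_apply, Pi.smul_apply, Submodule.coe_add, Submodule.coe_smul,
      MvPolynomial.coeff_add, MvPolynomial.coeff_smul, smul_eq_mul]
    refine ⟨(i1.const_mul a).add i2, ?_⟩
    rw [integral_add (i1.const_mul a) i2, integral_const_mul, z1, z2]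
    simp

/-- The space of cusp forms of weight `(k,k)` and level `U`; for `U = Ω₀(𝔫)` this is
`S_{k,k}(Ω₀(𝔫))`. -/
def cuspForms (σ : F →+* ℂ) (k : ℕ) (U : Subgroup (GL2Fin F)) :
    Submodule ℂ (GL2Adele F → WeightSpace k) where
  carrier := {f | IsCuspForm σ k U f}
  zero_mem' := IsCuspForm.zero σ k U
  add_mem' := by
    intro f f' hf hf'
    simpa using hf.linear hf' 1
  smul_mem' := by
    intro a f hf
    simpa using hf.linear (IsCuspForm.zero σ k U) a

/-- The pullback of functions along `GL₂(𝔸_F) → PGL₂^f(𝔸_F)`. -/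
def pullback (k : ℕ) : (PGL2f F → WeightSpace k) →ₗ[ℂ] (GL2Adele F → WeightSpace k) where
  toFun φ := fun g => φ (g.1, toPGL g.2)
  map_add' _ _ := rfl
  map_smul' _ _ := rfl

/-- Cusp forms of weight `(k,k)` on `PGL₂^f(𝔸_F)`, of level a subgroup `U ⊆ GL₂(𝔸_F^f)`:
functions on `PGL₂^f(𝔸_F)` which are cusp forms when viewed as functions on `GL₂(𝔸_F)`. -/
def cuspFormsPGL (σ : F →+* ℂ) (k : ℕ) (U : Subgroup (GL2Fin F)) :
    Submodule ℂ (PGL2f F → WeightSpace k) :=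
  (cuspForms σ k U).comap (pullback k)

end CuspForms

/-! ### The Bruhat--Tits tree -/

section Tree

variable {F : Type*} [Field F] [NumberField F] (𝔭 : HeightOneSpectrum (𝓞 F))

/-- The completion `F_𝔭`. -/
abbrev Loc := 𝔭.adicCompletion F

/-- The ring of integers `𝒪_𝔭`. -/
abbrev LocInt := 𝔭.adicCompletionIntegers F

/-- The `𝒪_𝔭`-lattices in `F_𝔭²`. -/
def Lattice := {L : Submodule (LocInt 𝔭) (Fin 2 → Loc 𝔭) // L.IsLattice (Loc 𝔭)}

variable {𝔭}

/-- The action of a matrix on (column) vectors, as an `𝒪_𝔭`-linear map. -/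
def act (g : GL (Fin 2) (Loc 𝔭)) : (Fin 2 → Loc 𝔭) →ₗ[LocInt 𝔭] (Fin 2 → Loc 𝔭) :=
  (Matrix.toLin' g.1).restrictScalars (LocInt 𝔭)

@[simp]
theorem act_apply (g : GL (Fin 2) (Loc 𝔭)) (x : Fin 2 → Loc 𝔭) : act g x = g.1 *ᵥ x := rfl

theorem act_one : act (1 : GL (Fin 2) (Loc 𝔭)) = LinearMap.id := by
  refine LinearMap.ext fun x => ?_
  simp

theorem act_mul (g h : GL (Fin 2) (Loc 𝔭)) : act (g * h) = act g ∘ₗ act h := by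
  refine LinearMap.ext fun x => ?_
  change (g.1 * h.1) *ᵥ x = g.1 *ᵥ (h.1 *ᵥ x)
  rw [Matrix.mulVec_mulVec]

theorem act_injective (g : GL (Fin 2) (Loc 𝔭)) : Function.Injective (act g) := by
  intro x y h
  have := congrArg (act g⁻¹) h
  rw [← LinearMap.comp_apply, ← LinearMap.comp_apply, ← act_mul, inv_mul_cancel, act_one] at this
  exact this

instance : MulAction (GL (Fin 2) (Loc 𝔭)) (Lattice 𝔭) where
  smul g L := ⟨L.1.map (act g), by
    refine ⟨L.2.fg.map _, ?_⟩
    have h : Submodule.span (Loc 𝔭) ((L.1.map (act g) : Submodule _ _) : Set (Fin 2 → Loc 𝔭))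
        = (Submodule.span (Loc 𝔭) (L.1 : Set (Fin 2 → Loc 𝔭))).map (Matrix.toLin' g.1) := by
      rw [Submodule.map_span]; rfl
    rw [h, L.2.span_eq_top, Submodule.map_top, LinearMap.range_eq_top]
    intro y
    refine ⟨(g⁻¹ : GL (Fin 2) (Loc 𝔭)).1 *ᵥ y, ?_⟩
    change act g (act g⁻¹ y) = y
    rw [← LinearMap.comp_apply, ← act_mul, mul_inv_cancel, act_one]
    rfl⟩
  one_smul L := Subtype.ext (by
    change L.1.map (act 1) = L.1
    rw [act_one, Submodule.map_id])
  mul_smul g h L := Subtype.ext (by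
    change L.1.map (act (g * h)) = (L.1.map (act h)).map (act g)
    rw [act_mul, Submodule.map_comp])

theorem Lattice.coe_smul (g : GL (Fin 2) (Loc 𝔭)) (L : Lattice 𝔭) :
    (g • L).1 = L.1.map (act g) := rfl

/-- Homothety of lattices. -/
instance homothety : Setoid (Lattice 𝔭) where
  r L M := ∃ c : (Loc 𝔭)ˣ, GeneralLinearGroup.scalar (Fin 2) c • L = M
  iseqv := by
    refine ⟨fun L => ⟨1, by simp⟩, ?_, ?_⟩
    · rintro L M ⟨c, rfl⟩
      exact ⟨c⁻¹, by rw [← mul_smul, ← map_mul]; simp⟩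
    · rintro L M N ⟨c, rfl⟩ ⟨d, rfl⟩
      exact ⟨d * c, by rw [← mul_smul, ← map_mul]⟩

variable (𝔭) in
/-- The vertices of the tree: homothety classes of lattices. -/
def Vertex := Quotient (homothety (𝔭 := 𝔭))

/-- The homothety class of a lattice. -/
def Lattice.toVertex (L : Lattice 𝔭) : Vertex 𝔭 := Quotient.mk _ L

instance : MulAction (GL (Fin 2) (Loc 𝔭)) (Vertex 𝔭) where
  smul g := Quotient.map (fun L => g • L) (by
    rintro L _ ⟨c, rfl⟩
    exact ⟨c, by rw [← mul_smul, ← mul_smul, GeneralLinearGroup.scalar_commute]⟩)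
  one_smul v := by
    induction v using Quotient.ind with | _ L =>
    exact congrArg Lattice.toVertex (one_smul _ L)
  mul_smul g h v := by
    induction v using Quotient.ind with | _ L =>
    exact congrArg Lattice.toVertex (mul_smul g h L)

theorem smul_toVertex (g : GL (Fin 2) (Loc 𝔭)) (L : Lattice 𝔭) :
    g • L.toVertex = (g • L).toVertex := rfl

variable (𝔭) in
/-- The Bruhat--Tits tree of `GL₂(F_𝔭)`: distinct vertices are joined if they have
representatives with `𝔭 M ⊆ L ⊆ M`. -/
def tree : SimpleGraph (Vertex 𝔭) :=
  SimpleGraph.fromRel fun v w => ∃ L M : Lattice 𝔭, L.toVertex = v ∧ M.toVertex = w ∧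
    IsLocalRing.maximalIdeal (LocInt 𝔭) • M.1 ≤ L.1 ∧ L.1 ≤ M.1

variable (𝔭) in
/-- The oriented edges of the tree. For an edge `e`, the source is `e.fst`, the target is `e.snd`,
and `e.symm` is the edge with reversed orientation. -/
abbrev Edge := (tree 𝔭).Dart

theorem rel_smul (g : GL (Fin 2) (Loc 𝔭)) {v w : Vertex 𝔭}
    (h : ∃ L M : Lattice 𝔭, L.toVertex = v ∧ M.toVertex = w ∧
      IsLocalRing.maximalIdeal (LocInt 𝔭) • M.1 ≤ L.1 ∧ L.1 ≤ M.1) :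
    ∃ L M : Lattice 𝔭, L.toVertex = g • v ∧ M.toVertex = g • w ∧
      IsLocalRing.maximalIdeal (LocInt 𝔭) • M.1 ≤ L.1 ∧ L.1 ≤ M.1 := by
  obtain ⟨L, M, rfl, rfl, h1, h2⟩ := h
  refine ⟨g • L, g • M, rfl, rfl, ?_, Submodule.map_mono h2⟩
  rw [Lattice.coe_smul, Lattice.coe_smul, ← Submodule.map_smul'']
  exact Submodule.map_mono h1

theorem adj_smul (g : GL (Fin 2) (Loc 𝔭)) {v w : Vertex 𝔭} (h : (tree 𝔭).Adj v w) :
    (tree 𝔭).Adj (g • v) (g • w) := by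
  rw [tree, SimpleGraph.fromRel_adj] at h ⊢
  exact ⟨fun he => h.1 (MulAction.injective g he), h.2.imp (rel_smul g) (rel_smul g)⟩

instance : MulAction (GL (Fin 2) (Loc 𝔭)) (Edge 𝔭) where
  smul g e := ⟨(g • e.fst, g • e.snd), adj_smul g e.adj⟩
  one_smul e := SimpleGraph.Dart.ext _ _ (Prod.ext (one_smul _ e.fst) (one_smul _ e.snd))
  mul_smul g h e := SimpleGraph.Dart.ext _ _ (Prod.ext (mul_smul g h e.fst) (mul_smul g h e.snd))

variable (𝔭)

variable {𝔭} in
/-- The submodule `𝒪_𝔭 ⊕ I` of `F_𝔭²`, for an ideal `I` of `𝒪_𝔭`. -/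
def stdSubmodule (I : Ideal (LocInt 𝔭)) : Submodule (LocInt 𝔭) (Fin 2 → Loc 𝔭) where
  carrier := {x | (∃ a : LocInt 𝔭, (a : Loc 𝔭) = x 0) ∧ ∃ b ∈ I, (b : Loc 𝔭) = x 1}
  zero_mem' := ⟨⟨0, rfl⟩, 0, I.zero_mem, rfl⟩
  add_mem' := by
    rintro x y ⟨⟨a, ha⟩, b, hb, hb'⟩ ⟨⟨c, hc⟩, d, hd, hd'⟩
    exact ⟨⟨a + c, by simp [ha, hc]⟩, b + d, I.add_mem hb hd, by simp [hb', hd']⟩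
  smul_mem' := by
    rintro r x ⟨⟨a, ha⟩, b, hb, hb'⟩
    exact ⟨⟨r * a, by simp [← ha, Algebra.smul_def]⟩, r * b, I.mul_mem_left r hb,
      by simp [← hb', Algebra.smul_def]⟩

theorem stdSubmodule_isLattice (I : Ideal (LocInt 𝔭)) (hI : I ≠ ⊥) :
    (stdSubmodule I).IsLattice (Loc 𝔭) := by
  obtain ⟨b, hb⟩ := (IsPrincipalIdealRing.principal I).principal
  have hbI : b ∈ I := hb ▸ Submodule.mem_span_singleton_self b
  have hb0 : (b : Loc 𝔭) ≠ 0 := by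
    intro h
    apply hI
    rw [hb, Submodule.span_singleton_eq_bot]
    exact Subtype.ext h
  refine ⟨?_, ?_⟩
  · have : stdSubmodule I = Submodule.span (LocInt 𝔭) {![1, 0], ![0, (b : Loc 𝔭)]} := by
      apply le_antisymm
      · rintro x ⟨⟨a, ha⟩, d, hd, hd'⟩
        rw [hb, Submodule.mem_span_singleton] at hd
        obtain ⟨r, rfl⟩ := hd
        rw [Submodule.mem_span_pair]
        refine ⟨a, r, ?_⟩
        funext i
        fin_cases i
        · simp [← ha, Algebra.smul_def]
        · simp [← hd', Algebra.smul_def]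
      · rw [Submodule.span_le]
        rintro x (rfl | rfl)
        · exact ⟨⟨1, rfl⟩, 0, I.zero_mem, rfl⟩
        · exact ⟨⟨0, rfl⟩, b, hbI, rfl⟩
    rw [this]
    exact Submodule.fg_span (by simp)
  · rw [eq_top_iff]
    intro x _
    have h1 : ![1, 0] ∈ stdSubmodule I := ⟨⟨1, rfl⟩, 0, I.zero_mem, rfl⟩
    have h2 : ![0, (b : Loc 𝔭)] ∈ stdSubmodule I := ⟨⟨0, rfl⟩, b, hbI, rfl⟩
    have : x = x 0 • ![1, 0] + (x 1 / b) • ![0, (b : Loc 𝔭)] := by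
      funext i
      fin_cases i
      · simp
      · simp [hb0]
    rw [this]
    exact add_mem (Submodule.smul_mem _ _ (Submodule.subset_span h1))
      (Submodule.smul_mem _ _ (Submodule.subset_span h2))

/-- The lattice `𝒪_𝔭 ⊕ 𝒪_𝔭`. -/
def stdLattice : Lattice 𝔭 := ⟨stdSubmodule ⊤, stdSubmodule_isLattice 𝔭 ⊤ top_ne_bot⟩

/-- The lattice `𝒪_𝔭 ⊕ π𝒪_𝔭`. -/
def stdLattice' : Lattice 𝔭 :=
  ⟨stdSubmodule (IsLocalRing.maximalIdeal (LocInt 𝔭)),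
    stdSubmodule_isLattice 𝔭 _ (IsDiscreteValuationRing.not_a_field _)⟩

theorem stdLattice_adj : (tree 𝔭).Adj (stdLattice 𝔭).toVertex (stdLattice' 𝔭).toVertex := by
  rw [tree, SimpleGraph.fromRel_adj]
  refine ⟨?_, Or.inr ⟨stdLattice' 𝔭, stdLattice 𝔭, rfl, rfl, ?_, ?_⟩⟩
  · intro h
    obtain ⟨c, hc⟩ := Quotient.exact h
    have hc' : (stdSubmodule ⊤).map (act (GeneralLinearGroup.scalar (Fin 2) c))
        = stdSubmodule (IsLocalRing.maximalIdeal (LocInt 𝔭)) := congrArg Subtype.val hc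
    have h1 : ![0, (c : Loc 𝔭)] ∈ stdSubmodule (IsLocalRing.maximalIdeal (LocInt 𝔭)) := by
      rw [← hc']
      refine ⟨![0, 1], ⟨⟨0, rfl⟩, 1, trivial, rfl⟩, ?_⟩
      funext i
      fin_cases i <;> simp [Matrix.mulVec_diagonal]
    have h2 : ![(1 : Loc 𝔭), 0] ∈ (stdSubmodule ⊤).map
        (act (GeneralLinearGroup.scalar (Fin 2) c)) := by
      rw [hc']
      exact ⟨⟨1, rfl⟩, 0, Ideal.zero_mem _, rfl⟩
    obtain ⟨_, d, hd, hd'⟩ := h1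
    obtain ⟨x, ⟨⟨a, ha⟩, _⟩, hx⟩ := h2
    have hx0 := congrFun hx 0
    simp [Matrix.mulVec_diagonal, ← ha] at hx0
    simp at hd'
    have h3 : d * a = 1 := Subtype.ext (by simpa [hd'] using hx0)
    have h4 : (1 : LocInt 𝔭) ∈ IsLocalRing.maximalIdeal (LocInt 𝔭) :=
      h3 ▸ Ideal.mul_mem_right a _ hd
    exact (IsLocalRing.maximalIdeal.isMaximal (LocInt 𝔭)).ne_top ((Ideal.eq_top_iff_one _).2 h4)
  · refine Submodule.smul_le.2 fun r hr x hx => ?_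
    obtain ⟨⟨a, ha⟩, b, _, hb⟩ := hx
    exact ⟨⟨r * a, by simp [← ha, Algebra.smul_def]⟩, r * b, Ideal.mul_mem_right b _ hr,
      by simp [← hb, Algebra.smul_def]⟩
  · rintro x ⟨h, b, _, hb⟩
    exact ⟨h, b, trivial, hb⟩

/-- The standard edge, from the class of `𝒪_𝔭 ⊕ 𝒪_𝔭` to the class of `𝒪_𝔭 ⊕ π𝒪_𝔭`. -/
def stdEdge : Edge 𝔭 := ⟨((stdLattice 𝔭).toVertex, (stdLattice' 𝔭).toVertex), stdLattice_adj 𝔭⟩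

/-! ### Finiteness facts, which make the sums below finite -/

theorem residue_surjective : Function.Surjective
    ((IsLocalRing.residue (LocInt 𝔭)).comp (algebraMap (𝓞 F) (LocInt 𝔭))) := by
  intro y
  obtain ⟨x, rfl⟩ := IsLocalRing.residue_surjective y
  have hlt : ∀ z : Loc 𝔭, Valued.v z < 1 → ∃ w ∈ IsLocalRing.maximalIdeal (LocInt 𝔭),
      (w : Loc 𝔭) = z := by
    intro z hz
    refine ⟨⟨z, hz.le⟩, ?_, rfl⟩
    rw [IsLocalRing.mem_maximalIdeal, mem_nonunits_iff,
      HeightOneSpectrum.adicCompletionIntegers.isUnit_iff_valued_eq_one]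
    exact hz.ne
  have hopen : IsOpen {z : Loc 𝔭 | Valued.v (z - x) < 1} := by
    have h1 : IsOpen {z : Loc 𝔭 | Valued.v z < 1} := by
      simpa [Valuation.restrict_lt_one_iff] using Valued.isOpen_ball (Loc 𝔭) 1
    exact h1.preimage (continuous_sub_right (x : Loc 𝔭))
  obtain ⟨k, hk⟩ := (HeightOneSpectrum.denseRange_algebraMap F 𝔭).exists_mem_open hopen
    ⟨(x : Loc 𝔭), by simp⟩
  have hk1 : 𝔭.valuation F k ≤ 1 := by
    have h2 : Valued.v (algebraMap F (Loc 𝔭) k) ≤ 1 := by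
      have := Valuation.map_add Valued.v (algebraMap F (Loc 𝔭) k - x) (x : Loc 𝔭)
      rw [sub_add_cancel] at this
      exact this.trans (max_le hk.le x.2)
    rwa [HeightOneSpectrum.algebraMap_adicCompletion, Function.comp_apply,
      HeightOneSpectrum.valuedAdicCompletion_eq_valuation'] at h2
  obtain ⟨a, ha⟩ := 𝔭.exists_valuation_sub_lt_of_integer hk1 1
  refine ⟨a, ?_⟩
  rw [RingHom.comp_apply, ← sub_eq_zero, ← map_sub, IsLocalRing.residue_eq_zero_iff]
  obtain ⟨w, hw, hw'⟩ := hlt (((algebraMap (𝓞 F) (LocInt 𝔭) a : LocInt 𝔭) : Loc 𝔭) - x) (by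
    have e : ((algebraMap (𝓞 F) (LocInt 𝔭) a : LocInt 𝔭) : Loc 𝔭) - x
        = algebraMap F (Loc 𝔭) (algebraMap (𝓞 F) F a - k) + (algebraMap F (Loc 𝔭) k - x) := by
      rw [map_sub]
      simp
      rfl
    rw [e]
    refine lt_of_le_of_lt (Valuation.map_add _ _ _) (max_lt ?_ hk)
    rw [HeightOneSpectrum.algebraMap_adicCompletion, Function.comp_apply]
    change Valued.v ((algebraMap (𝓞 F) F a - k : F) : Loc 𝔭) < 1
    rw [HeightOneSpectrum.valuedAdicCompletion_eq_valuation']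
    exact ha)
  rwa [show algebraMap (𝓞 F) (LocInt 𝔭) a - x = w from Subtype.ext hw'.symm]

instance finite_residueField : Finite (IsLocalRing.ResidueField (LocInt 𝔭)) := by
  have : Finite (𝓞 F ⧸ 𝔭.asIdeal) := Ideal.finiteQuotientOfFreeOfNeBot _ 𝔭.ne_bot
  let f : 𝓞 F →+* IsLocalRing.ResidueField (LocInt 𝔭) :=
    (IsLocalRing.residue (LocInt 𝔭)).comp (algebraMap (𝓞 F) (LocInt 𝔭))
  have hf : ∀ a ∈ 𝔭.asIdeal, f a = 0 := by
    intro a ha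
    rw [RingHom.comp_apply, IsLocalRing.residue_eq_zero_iff, IsLocalRing.mem_maximalIdeal,
      mem_nonunits_iff, HeightOneSpectrum.adicCompletionIntegers.isUnit_iff_valued_eq_one]
    rw [← HeightOneSpectrum.valuation_lt_one_iff_mem (K := F),
      ← HeightOneSpectrum.valuedAdicCompletion_eq_valuation'] at ha
    exact ha.ne
  refine Finite.of_surjective (Ideal.Quotient.lift 𝔭.asIdeal f hf) fun y => ?_
  obtain ⟨a, rfl⟩ := residue_surjective 𝔭 y
  exact ⟨Ideal.Quotient.mk _ a, by simp [f]⟩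

variable {𝔭}

theorem finite_between (L : Lattice 𝔭) :
    {S : Submodule (LocInt 𝔭) (Fin 2 → Loc 𝔭) |
      IsLocalRing.maximalIdeal (LocInt 𝔭) • L.1 ≤ S ∧ S ≤ L.1}.Finite := by
  set m := IsLocalRing.maximalIdeal (LocInt 𝔭) with hm
  have : Module.Finite (LocInt 𝔭) L.1 := Module.Finite.iff_fg.2 L.2.fg
  have : Finite (LocInt 𝔭 ⧸ m) := finite_residueField 𝔭
  have : Module.Finite (LocInt 𝔭 ⧸ m) (L.1 ⧸ (m • ⊤ : Submodule (LocInt 𝔭) L.1)) :=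
    Module.Finite.of_restrictScalars_finite (LocInt 𝔭) _ _
  have : Finite (L.1 ⧸ (m • ⊤ : Submodule (LocInt 𝔭) L.1)) :=
    Module.finite_of_finite (LocInt 𝔭 ⧸ m)
  let q := (m • ⊤ : Submodule (LocInt 𝔭) L.1).mkQ
  have hmt : (m • ⊤ : Submodule (LocInt 𝔭) L.1).map L.1.subtype = m • L.1 := by
    rw [Submodule.map_smul'', Submodule.map_top, Submodule.range_subtype]
  have hinj : Set.InjOn (fun S : Submodule (LocInt 𝔭) (Fin 2 → Loc 𝔭) =>
      q '' {x : L.1 | (x : Fin 2 → Loc 𝔭) ∈ S})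
      {S | m • L.1 ≤ S ∧ S ≤ L.1} := by
    have key : ∀ S T : Submodule (LocInt 𝔭) (Fin 2 → Loc 𝔭), S ≤ L.1 → m • L.1 ≤ T →
        q '' {x : L.1 | (x : Fin 2 → Loc 𝔭) ∈ S} = q '' {x : L.1 | (x : Fin 2 → Loc 𝔭) ∈ T} →
        S ≤ T := by
      intro S T hS hT h x hx
      have h1 : q ⟨x, hS hx⟩ ∈ q '' {x : L.1 | (x : Fin 2 → Loc 𝔭) ∈ T} := h ▸ ⟨_, hx, rfl⟩
      obtain ⟨y, hy, hyx⟩ := h1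
      have h2 : (⟨x, hS hx⟩ : L.1) - y ∈ (m • ⊤ : Submodule (LocInt 𝔭) L.1) := by
        rw [← Submodule.Quotient.eq]
        exact hyx.symm
      have h3 : x - y ∈ m • L.1 := by
        rw [← hmt]
        exact ⟨_, h2, rfl⟩
      have := T.add_mem (hT h3) hy
      rwa [sub_add_cancel] at this
    intro S hS T hT h
    exact le_antisymm (key S T hS.2 hT.1 h) (key T S hT.2 hS.1 h.symm)
  exact Set.Finite.of_finite_image (Set.toFinite _) hinj

theorem smul_between (g : GL (Fin 2) (Loc 𝔭)) {L M : Lattice 𝔭}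
    (h : IsLocalRing.maximalIdeal (LocInt 𝔭) • M.1 ≤ L.1 ∧ L.1 ≤ M.1) :
    IsLocalRing.maximalIdeal (LocInt 𝔭) • (g • M).1 ≤ (g • L).1 ∧ (g • L).1 ≤ (g • M).1 := by
  refine ⟨?_, Submodule.map_mono h.2⟩
  rw [Lattice.coe_smul, Lattice.coe_smul, ← Submodule.map_smul'']
  exact Submodule.map_mono h.1

theorem exists_uniformizer_smul : ∃ c : (Loc 𝔭)ˣ, ∀ L : Lattice 𝔭,
    (GeneralLinearGroup.scalar (Fin 2) c • L).1 = IsLocalRing.maximalIdeal (LocInt 𝔭) • L.1 := by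
  obtain ⟨b, hb⟩ := IsDiscreteValuationRing.exists_irreducible (LocInt 𝔭)
  have hb0 : (b : Loc 𝔭) ≠ 0 := fun h => hb.ne_zero (Subtype.ext h)
  refine ⟨Units.mk0 _ hb0, fun L => ?_⟩
  have ha : ∀ x : Fin 2 → Loc 𝔭, act (GeneralLinearGroup.scalar (Fin 2) (Units.mk0 _ hb0)) x
      = b • x := by
    intro x
    funext i
    fin_cases i <;> simp [Matrix.mulVec_diagonal, Algebra.smul_def]
  rw [hb.maximalIdeal_eq, Submodule.ideal_span_singleton_smul]
  ext x
  rw [Submodule.mem_smul_pointwise_iff_exists, Lattice.coe_smul, Submodule.mem_map]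
  simp only [ha]

theorem finite_edges (v : Vertex 𝔭) : {e : Edge 𝔭 | e.fst = v}.Finite := by
  obtain ⟨L, rfl⟩ : ∃ L : Lattice 𝔭, L.toVertex = v := Quotient.exists_rep v
  have key : ∀ w, (tree 𝔭).Adj L.toVertex w → ∃ S : Lattice 𝔭, S.toVertex = w ∧
      IsLocalRing.maximalIdeal (LocInt 𝔭) • L.1 ≤ S.1 ∧ S.1 ≤ L.1 := by
    intro w hw
    rw [tree, SimpleGraph.fromRel_adj] at hw
    have hs : ∀ (c : (Loc 𝔭)ˣ) (M : Lattice 𝔭),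
        (GeneralLinearGroup.scalar (Fin 2) c • M).toVertex = M.toVertex :=
      fun c M => (Quotient.sound ⟨c, rfl⟩ : M.toVertex = _).symm
    rcases hw.2 with ⟨L', M, hL, rfl, h⟩ | ⟨S, L', rfl, hL, h⟩
    · obtain ⟨c, rfl⟩ := Quotient.exact hL
      obtain ⟨d, hd⟩ := exists_uniformizer_smul (𝔭 := 𝔭)
      have h' := smul_between (GeneralLinearGroup.scalar (Fin 2) c) h
      refine ⟨GeneralLinearGroup.scalar (Fin 2) d • GeneralLinearGroup.scalar (Fin 2) c • M,
        by rw [hs, hs], ?_, ?_⟩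
      · rw [hd]; exact Submodule.smul_mono le_rfl h'.2
      · rw [hd]; exact h'.1
    · obtain ⟨c, rfl⟩ := Quotient.exact hL
      exact ⟨GeneralLinearGroup.scalar (Fin 2) c • S, hs c S, smul_between _ h⟩
  have hfin : (Set.range fun S : {S : Lattice 𝔭 //
      IsLocalRing.maximalIdeal (LocInt 𝔭) • L.1 ≤ S.1 ∧ S.1 ≤ L.1} => S.1.toVertex).Finite := by
    have : Finite {S : Lattice 𝔭 //
        IsLocalRing.maximalIdeal (LocInt 𝔭) • L.1 ≤ S.1 ∧ S.1 ≤ L.1} := by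
      have := (finite_between L).to_subtype
      exact Finite.of_injective (fun S => (⟨S.1.1, S.2⟩ : {S : Submodule (LocInt 𝔭) _ |
        IsLocalRing.maximalIdeal (LocInt 𝔭) • L.1 ≤ S ∧ S ≤ L.1}))
        fun S T h => Subtype.ext (Subtype.ext (by
          have := Subtype.ext_iff.1 h
          exact this))
    exact Set.finite_range _
  refine Set.Finite.of_finite_image (f := fun e : Edge 𝔭 => e.snd) (hfin.subset ?_) ?_
  · rintro _ ⟨e, he, rfl⟩
    obtain ⟨S, hS, hS'⟩ := key e.snd (he ▸ e.adj)
    exact ⟨⟨S, hS'⟩, hS⟩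
  · intro e he e' he' h
    exact SimpleGraph.Dart.ext _ _ (Prod.ext (he.trans he'.symm) h)

theorem finite_edges' (v : Vertex 𝔭) : {e : Edge 𝔭 | e.snd = v}.Finite := by
  refine Set.Finite.of_finite_image (f := SimpleGraph.Dart.symm) ((finite_edges v).subset ?_)
    SimpleGraph.Dart.symm_involutive.injective.injOn
  rintro _ ⟨e, he, rfl⟩
  exact he

end Tree

/-! ### Bianchi cusp forms on the tree -/

section Forms

variable {F : Type*} [Field F] [NumberField F]

/-- Harmonicity of a function on the oriented edges of the tree. -/
structure IsHarmonic {𝔭 : HeightOneSpectrum (𝓞 F)} {V : Type*} [AddCommGroup V]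
    (f : Edge 𝔭 → V) : Prop where
  symm : ∀ e, f e.symm = -f e
  source : ∀ v : Vertex 𝔭, ∑ᶠ e ∈ {e : Edge 𝔭 | e.fst = v}, f e = 0
  target : ∀ v : Vertex 𝔭, ∑ᶠ e ∈ {e : Edge 𝔭 | e.snd = v}, f e = 0

/-- The preimage in `GL₂(𝔸_F^f)` of `Ω_e = Stab_Ω(e)`, where `γ ∈ Ω` acts on the tree through its
component at `𝔭`. -/
def edgeStabilizer (p : ℕ) (𝔭 : HeightOneSpectrum (𝓞 F)) (𝔪 : Ideal (𝓞 F)) (e : Edge 𝔭) :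
    Subgroup (GL2Fin F) :=
  (Omega p 𝔭 𝔪).comap toPGL ⊓
    (MulAction.stabilizer (GL (Fin 2) (𝔭.adicCompletion F)) e).comap (localGL 𝔭)

/-- The space `𝕊_{k,k}(Ω, 𝒯_𝔭)` of cusp forms of weight `(k,k)` for `Ω` on
`ℰ(𝒯_𝔭) × PGL₂^f(𝔸_F)`. -/
def treeForms (σ : F →+* ℂ) (p : ℕ) (𝔭 : HeightOneSpectrum (𝓞 F)) (𝔪 : Ideal (𝓞 F)) (k : ℕ) :
    Submodule ℂ (Edge 𝔭 → PGL2f F → WeightSpace k) where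
  carrier := {Φ |
    (∀ γ : GL2Fin F, toPGL γ ∈ Omega p 𝔭 𝔪 → ∀ (e : Edge 𝔭) (g : PGL2f F),
      Φ (localGL 𝔭 γ • e) (g.1, g.2 * (toPGL γ)⁻¹) = Φ e g) ∧
    (∀ g : PGL2f F, IsHarmonic fun e => Φ e g) ∧
    ∀ e : Edge 𝔭, Φ e ∈ cuspFormsPGL σ k (edgeStabilizer p 𝔭 𝔪 e)}
  zero_mem' := ⟨fun _ _ _ _ => rfl, fun g => ⟨by simp, by simp, by simp⟩,
    fun e => Submodule.zero_mem _⟩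
  add_mem' := by
    rintro Φ Ψ ⟨h1, h2, h3⟩ ⟨h1', h2', h3'⟩
    refine ⟨fun γ hγ e g => ?_, fun g => ⟨fun e => ?_, fun v => ?_, fun v => ?_⟩,
      fun e => Submodule.add_mem _ (h3 e) (h3' e)⟩
    · simp [h1 γ hγ e g, h1' γ hγ e g]
    · simp [(h2 g).symm e, (h2' g).symm e, add_comm]
    · simp only [Pi.add_apply]
      rw [finsum_mem_add_distrib (finite_edges v), (h2 g).source v, (h2' g).source v, add_zero]
    · simp only [Pi.add_apply]
      rw [finsum_mem_add_distrib (finite_edges' v), (h2 g).target v, (h2' g).target v, add_zero]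
  smul_mem' := by
    rintro a Φ ⟨h1, h2, h3⟩
    refine ⟨fun γ hγ e g => ?_, fun g => ⟨fun e => ?_, fun v => ?_, fun v => ?_⟩,
      fun e => Submodule.smul_mem _ a (h3 e)⟩
    · simp [h1 γ hγ e g]
    · simp [(h2 g).symm e]
    · simp only [Pi.smul_apply]
      rw [← smul_finsum_mem (finite_edges v), (h2 g).source v, smul_zero]
    · simp only [Pi.smul_apply]
      rw [← smul_finsum_mem (finite_edges' v), (h2 g).target v, smul_zero]

/-! ### Degeneracy maps and `𝔭`-new forms -/

/-- An element `α` of `GL₂(F_𝔭)`, viewed in `GL₂(𝔸_F^f)`, which reverses the standard edge. -/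
def IsAtkinLehner (𝔭 : HeightOneSpectrum (𝓞 F)) (α : GL2Fin F) : Prop :=
  (∀ v, v ≠ 𝔭 → localGL v α = 1) ∧ localGL 𝔭 α • stdEdge 𝔭 = (stdEdge 𝔭).symm

/-- The set of left cosets of `Ω₀(𝔭𝔪)` in `Ω₀(𝔪)`. -/
abbrev LevelCosets (𝔭 : HeightOneSpectrum (𝓞 F)) (𝔪 : Ideal (𝓞 F)) :=
  Omega0 𝔪 ⧸ (Omega0 (𝔭.asIdeal * 𝔪)).subgroupOf (Omega0 𝔪)

theorem map_eq_top_of_not_le {I : Ideal (𝓞 F)} {v : HeightOneSpectrum (𝓞 F)}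
    (h : ¬ I ≤ v.asIdeal) :
    I.map (algebraMap (𝓞 F) (v.adicCompletionIntegers F)) = ⊤ := by
  obtain ⟨a, ha, hav⟩ := SetLike.not_le_iff_exists.1 h
  refine Ideal.eq_top_of_isUnit_mem _ (Ideal.mem_map_of_mem _ ha) ?_
  rw [HeightOneSpectrum.adicCompletionIntegers.isUnit_iff_valued_eq_one]
  change Valued.v ((algebraMap (𝓞 F) F a : F) : v.adicCompletion F) = 1
  rw [HeightOneSpectrum.valuedAdicCompletion_eq_valuation']
  exact v.valuation_eq_one_iff_notMem.2 hav

theorem maximalIdeal_le_map (v : HeightOneSpectrum (𝓞 F)) :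
    IsLocalRing.maximalIdeal (v.adicCompletionIntegers F)
      ≤ v.asIdeal.map (algebraMap (𝓞 F) (v.adicCompletionIntegers F)) := by
  intro x hx
  obtain ⟨a, ha⟩ := v.intValuation_exists_uniformizer
  have hav : Valued.v ((algebraMap (𝓞 F) F a : F) : v.adicCompletion F) = WithZero.exp (-1 : ℤ) := by
    rw [HeightOneSpectrum.valuedAdicCompletion_eq_valuation', ← ha]
    exact v.valuation_of_algebraMap a
  have ham : a ∈ v.asIdeal := by
    rw [← HeightOneSpectrum.intValuation_lt_one_iff_mem, ha, ← WithZero.exp_zero,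
      WithZero.exp_lt_exp]
    norm_num
  have ha0 : ((algebraMap (𝓞 F) F a : F) : v.adicCompletion F) ≠ 0 := by
    intro h
    rw [h, map_zero] at hav
    exact WithZero.exp_ne_zero hav.symm
  have hxv : Valued.v (x : v.adicCompletion F) ≤ WithZero.exp (-1 : ℤ) := by
    rw [IsLocalRing.mem_maximalIdeal, mem_nonunits_iff,
      HeightOneSpectrum.adicCompletionIntegers.isUnit_iff_valued_eq_one] at hx
    have hlt : Valued.v (x : v.adicCompletion F) < 1 := lt_of_le_of_ne x.2 hx
    by_cases h0 : Valued.v (x : v.adicCompletion F) = 0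
    · rw [h0]; exact zero_le
    · rw [← WithZero.exp_log h0, ← WithZero.exp_zero, WithZero.exp_lt_exp] at hlt
      rw [← WithZero.exp_log h0, WithZero.exp_le_exp]
      omega
  have hy : (x : v.adicCompletion F) / ((algebraMap (𝓞 F) F a : F) : v.adicCompletion F)
      ∈ v.adicCompletionIntegers F := by
    rw [HeightOneSpectrum.mem_adicCompletionIntegers, map_div₀, hav]
    exact (div_le_one₀ (by simp)).2 hxv
  have hxe : x = algebraMap (𝓞 F) (v.adicCompletionIntegers F) a * ⟨_, hy⟩ := by
    refine Subtype.ext ?_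
    change (x : v.adicCompletion F) = ((algebraMap (𝓞 F) F a : F) : v.adicCompletion F) *
      ((x : v.adicCompletion F) / ((algebraMap (𝓞 F) F a : F) : v.adicCompletion F))
    rw [mul_div_cancel₀ _ ha0]
  rw [hxe]
  exact Ideal.mul_mem_right _ _ (Ideal.mem_map_of_mem _ ham)

theorem mem_localOrder_mul {𝔭 : HeightOneSpectrum (𝓞 F)} {𝔪 : Ideal (𝓞 F)}
    (h𝔪 : IsCoprime 𝔭.asIdeal 𝔪) {v : HeightOneSpectrum (𝓞 F)}
    {M : Matrix (Fin 2) (Fin 2) (v.adicCompletion F)} (hM : M ∈ localOrder 𝔪 v)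
    (h : v = 𝔭 → ∃ c ∈ IsLocalRing.maximalIdeal (v.adicCompletionIntegers F),
      (c : v.adicCompletion F) = M 1 0) :
    M ∈ localOrder (𝔭.asIdeal * 𝔪) v := by
  refine ⟨hM.1, ?_⟩
  rw [Ideal.map_mul]
  by_cases hv : v = 𝔭
  · obtain ⟨c, hc, hc'⟩ := h hv
    refine ⟨c, ?_, hc'⟩
    subst hv
    have h1 : ¬ 𝔪 ≤ v.asIdeal := by
      intro hle
      rw [Ideal.isCoprime_iff_sup_eq, sup_eq_left.2 hle] at h𝔪
      exact v.isPrime.ne_top h𝔪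
    rw [map_eq_top_of_not_le h1, Ideal.mul_top]
    exact maximalIdeal_le_map v hc
  · have h1 : ¬ 𝔭.asIdeal ≤ v.asIdeal := fun hle =>
      hv (HeightOneSpectrum.ext (𝔭.isMaximal.eq_of_le v.isPrime.ne_top hle).symm)
    rw [map_eq_top_of_not_le h1, Ideal.top_mul]
    exact hM.2

theorem finite_levelCosets {𝔭 : HeightOneSpectrum (𝓞 F)} {𝔪 : Ideal (𝓞 F)}
    (h𝔪 : IsCoprime 𝔭.asIdeal 𝔪) : Finite (LevelCosets 𝔭 𝔪) := by
  let red : Omega0 𝔪 → Fin 2 → Fin 2 → IsLocalRing.ResidueField (𝔭.adicCompletionIntegers F) :=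
    fun γ i j => IsLocalRing.residue _ ⟨(localGL 𝔭 γ.1).1 i j, (γ.2 𝔭 trivial).1.1 i j⟩
  have hred : ∀ γ δ : Omega0 𝔪, red γ = red δ → ∃ c ∈ IsLocalRing.maximalIdeal
      (𝔭.adicCompletionIntegers F),
        (c : 𝔭.adicCompletion F) = (localGL 𝔭 (γ.1⁻¹ * δ.1)).1 1 0 := by
    intro γ δ h
    have hd : ∀ i j, ∃ c ∈ IsLocalRing.maximalIdeal (𝔭.adicCompletionIntegers F),
        (c : 𝔭.adicCompletion F) = (localGL 𝔭 δ.1).1 i j - (localGL 𝔭 γ.1).1 i j := by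
      intro i j
      have hij := congrFun (congrFun h i) j
      simp only [red] at hij
      rw [eq_comm, ← sub_eq_zero, ← map_sub, IsLocalRing.residue_eq_zero_iff] at hij
      exact ⟨_, hij, rfl⟩
    obtain ⟨a, ha, ha'⟩ := hd 0 0
    obtain ⟨b, hb, hb'⟩ := hd 1 0
    have hI := (γ.2 𝔭 trivial).2.1
    refine ⟨⟨_, hI 1 0⟩ * a + ⟨_, hI 1 1⟩ * b,
      Ideal.add_mem _ (Ideal.mul_mem_left _ _ ha) (Ideal.mul_mem_left _ _ hb), ?_⟩
    have h0 : ((localGL 𝔭 γ.1⁻¹).1 * (localGL 𝔭 γ.1).1) 1 0 = 0 := by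
      rw [← Units.val_mul, ← map_mul, inv_mul_cancel, map_one]
      simp
    rw [Matrix.mul_apply, Fin.sum_univ_two] at h0
    rw [map_mul, Units.val_mul, Matrix.mul_apply, Fin.sum_univ_two]
    change (localGL 𝔭 γ.1⁻¹).1 1 0 * (a : 𝔭.adicCompletion F)
      + (localGL 𝔭 γ.1⁻¹).1 1 1 * (b : 𝔭.adicCompletion F) = _
    rw [ha', hb']
    linear_combination -h0
  refine Finite.of_injective (fun x : LevelCosets 𝔭 𝔪 => red x.out) fun x y h => ?_
  rw [← x.out_eq, ← y.out_eq]
  refine QuotientGroup.eq.2 ?_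
  rw [Subgroup.mem_subgroupOf]
  have hmem := (x.out⁻¹ * y.out).2
  intro v _
  refine ⟨mem_localOrder_mul h𝔪 (hmem v trivial).1 ?_, mem_localOrder_mul h𝔪 (hmem v trivial).2 ?_⟩
  · rintro rfl
    exact hred _ _ h
  · rintro rfl
    have e : ((x.out⁻¹ * y.out : Omega0 𝔪) : GL2Fin F)⁻¹ = y.out.1⁻¹ * x.out.1 := by
      simp
    rw [e]
    exact hred _ _ h.symm

/-- The degeneracy map `φ_s(f)(g) = ∑ f(g γ_i)`, with `γ_i` running over representatives of
`Ω₀(𝔪)/Ω₀(𝔭𝔪)`. -/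
def degS (𝔭 : HeightOneSpectrum (𝓞 F)) (𝔪 : Ideal (𝓞 F)) {k : ℕ}
    (f : PGL2f F → WeightSpace k) : PGL2f F → WeightSpace k :=
  fun g => ∑ᶠ x : LevelCosets 𝔭 𝔪, f (g.1, g.2 * toPGL x.out.1)

/-- The degeneracy map `φ_t(f)(g) = ∑ f(g γ_i α)`, with `γ_i` running over representatives of
`Ω₀(𝔪)/Ω₀(𝔭𝔪)`. -/
def degT (𝔭 : HeightOneSpectrum (𝓞 F)) (𝔪 : Ideal (𝓞 F)) (α : GL2Fin F) {k : ℕ}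
    (f : PGL2f F → WeightSpace k) : PGL2f F → WeightSpace k :=
  fun g => ∑ᶠ x : LevelCosets 𝔭 𝔪, f (g.1, g.2 * toPGL x.out.1 * toPGL α)

/-- The space `S_{k,k}(Ω₀(𝔭𝔪))^{𝔭-new}`: the kernel of `φ_s ⊕ φ_t`. -/
def newForms (σ : F →+* ℂ) (𝔭 : HeightOneSpectrum (𝓞 F)) (𝔪 : Ideal (𝓞 F))
    (h𝔪 : IsCoprime 𝔭.asIdeal 𝔪) (α : GL2Fin F) (k : ℕ) :
    Submodule ℂ (PGL2f F → WeightSpace k) where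
  carrier := {f | f ∈ cuspFormsPGL σ k (Omega0 (𝔭.asIdeal * 𝔪)) ∧
    degS 𝔭 𝔪 f = 0 ∧ degT 𝔭 𝔪 α f = 0}
  zero_mem' := by
    refine ⟨Submodule.zero_mem _, ?_, ?_⟩ <;> funext g <;> simp [degS, degT]
  add_mem' := by
    rintro f f' ⟨h1, h2, h3⟩ ⟨h1', h2', h3'⟩
    have := finite_levelCosets h𝔪
    refine ⟨Submodule.add_mem _ h1 h1', ?_, ?_⟩ <;> funext g
    · have e := congrFun h2 g
      have e' := congrFun h2' g
      simp only [degS, Pi.add_apply] at e e' ⊢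
      rw [finsum_add_distrib (Set.toFinite _) (Set.toFinite _), e, e']
      simp
    · have e := congrFun h3 g
      have e' := congrFun h3' g
      simp only [degT, Pi.add_apply] at e e' ⊢
      rw [finsum_add_distrib (Set.toFinite _) (Set.toFinite _), e, e']
      simp
  smul_mem' := by
    rintro a f ⟨h1, h2, h3⟩
    have := finite_levelCosets h𝔪
    refine ⟨Submodule.smul_mem _ a h1, ?_, ?_⟩ <;> funext g
    · have e := congrFun h2 g
      simp only [degS, Pi.smul_apply] at e ⊢
      rw [← smul_finsum, e]
      simp
    · have e := congrFun h3 g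
      simp only [degT, Pi.smul_apply] at e ⊢
      rw [← smul_finsum, e]
      simp

end Forms

end

end BianchiTree

open BianchiTree IsDedekindDomain NumberField

namespace BianchiTree

open Matrix

noncomputable section

/-! ### The action of `GL₂(F_𝔭)` on the tree -/

section Local

variable {F : Type*} [Field F] [NumberField F] {𝔭 : HeightOneSpectrum (𝓞 F)}

/-! The group `Ω` acts on the oriented edges with exactly two orbits, those of `e_*` and of its
reverse. Every edge is a `GL₂(F_𝔭)`-translate of `e_*`, because lattices have bases and `GL₂(𝒪_𝔭)`
permutes the neighbours of `[𝒪_𝔭 ⊕ 𝒪_𝔭]` transitively; an element of odd determinant is corrected by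
`α`, at the price of reversing the edge (`exists_mem_Omega_smul_stdEdge`). The two orbits are
distinct because an element reversing `e_*` has determinant of odd valuation
(`smul_stdEdge_ne_symm`).

An equivariant alternating function of edges is therefore determined by its value at `e_*`, and this
value may be any function invariant under the stabilizer of `e_*`. By coprimality of `𝔭` and `𝔪`
that stabilizer is the image of `Ω₀(𝔭𝔪)` (`exists_mem_Omega0_mul_of_smul_stdEdge`), which accounts
for the level. The value at another edge is, up to sign, a right translate by a finite adelic
matrix, which preserves all the analytic conditions (`IsCuspForm.translate`).

By equivariance, harmonicity only has to be tested at the two ends of `e_*`. The edges leaving `[𝒪_𝔭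
⊕ 𝒪_𝔭]` are the `γ_i e_*` (`finsum_levelCosets`), so there the condition is the vanishing of `φ_s`;
the edges entering `[𝒪_𝔭 ⊕ 𝔭]` are the `α⁻¹γ_iα e_*` (`finsum_levelCosets_symm`), which gives `φ_t`.
Harmonic thus means `𝔭`-new.

For class number one, a finite idele is a principal idele times a unit. Scalars of the second kind
lie in the level group; those of the first kind are moved by automorphy to the infinite place, where
the weight condition makes them act trivially. -/

theorem mem_maximalIdeal_iff_valued_lt_one {a : LocInt 𝔭} :
    a ∈ IsLocalRing.maximalIdeal (LocInt 𝔭) ↔ Valued.v (a : Loc 𝔭) < 1 := by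
  rw [IsLocalRing.mem_maximalIdeal, mem_nonunits_iff,
    HeightOneSpectrum.adicCompletionIntegers.isUnit_iff_valued_eq_one]
  exact ⟨fun h => lt_of_le_of_ne a.2 h, fun h => h.ne⟩

theorem mem_stdLattice {x : Fin 2 → Loc 𝔭} :
    x ∈ (stdLattice 𝔭).1 ↔ Valued.v (x 0) ≤ 1 ∧ Valued.v (x 1) ≤ 1 := by
  constructor
  · rintro ⟨⟨a, ha⟩, b, _, hb⟩
    exact ⟨ha ▸ a.2, hb ▸ b.2⟩
  · rintro ⟨h0, h1⟩
    exact ⟨⟨⟨x 0, h0⟩, rfl⟩, ⟨x 1, h1⟩, trivial, rfl⟩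

theorem mem_stdLattice' {x : Fin 2 → Loc 𝔭} :
    x ∈ (stdLattice' 𝔭).1 ↔ Valued.v (x 0) ≤ 1 ∧ Valued.v (x 1) < 1 := by
  constructor
  · rintro ⟨⟨a, ha⟩, b, hbm, hb⟩
    exact ⟨ha ▸ a.2, hb ▸ mem_maximalIdeal_iff_valued_lt_one.1 hbm⟩
  · rintro ⟨h0, h1⟩
    exact ⟨⟨⟨x 0, h0⟩, rfl⟩, ⟨x 1, h1.le⟩, mem_maximalIdeal_iff_valued_lt_one.2 h1, rfl⟩

theorem valued_add_le_one {x y : Loc 𝔭} (hx : Valued.v x ≤ 1) (hy : Valued.v y ≤ 1) :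
    Valued.v (x + y) ≤ 1 :=
  (Valuation.map_add _ _ _).trans (max_le hx hy)

theorem valued_mul_le_one {x y : Loc 𝔭} (hx : Valued.v x ≤ 1) (hy : Valued.v y ≤ 1) :
    Valued.v (x * y) ≤ 1 := by
  rw [map_mul]
  exact mul_le_one' hx hy

theorem smul_stdLattice_le {g : GL (Fin 2) (Loc 𝔭)} :
    (g • stdLattice 𝔭).1 ≤ (stdLattice 𝔭).1 ↔ ∀ i j, Valued.v (g.1 i j) ≤ 1 := by
  constructor
  · intro h i j
    have hj : (Pi.single j 1 : Fin 2 → Loc 𝔭) ∈ (stdLattice 𝔭).1 := by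
      rw [mem_stdLattice]
      fin_cases j <;> simp
    have := h ⟨_, hj, rfl⟩
    rw [mem_stdLattice] at this
    simp only [act_apply, Matrix.mulVec_single_one, Matrix.col_apply] at this
    fin_cases i
    exacts [this.1, this.2]
  · rintro h _ ⟨x, hx, rfl⟩
    have hx' := mem_stdLattice.1 hx
    rw [mem_stdLattice]
    simp only [act_apply, Matrix.mulVec, dotProduct, Fin.sum_univ_two]
    exact ⟨valued_add_le_one (valued_mul_le_one (h _ _) hx'.1) (valued_mul_le_one (h _ _) hx'.2),
      valued_add_le_one (valued_mul_le_one (h _ _) hx'.1) (valued_mul_le_one (h _ _) hx'.2)⟩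

theorem Lattice.smul_mono (g : GL (Fin 2) (Loc 𝔭)) {L M : Lattice 𝔭} (h : L.1 ≤ M.1) :
    (g • L).1 ≤ (g • M).1 :=
  Submodule.map_mono h

theorem Lattice.smul_eq_of_le {g : GL (Fin 2) (Loc 𝔭)} {L M : Lattice 𝔭} (h : (g • L).1 ≤ M.1)
    (h' : (g⁻¹ • M).1 ≤ L.1) : g • L = M := by
  refine Subtype.ext (le_antisymm h ?_)
  have := Lattice.smul_mono g h'
  rwa [smul_inv_smul] at this

theorem smul_stdLattice_eq {g : GL (Fin 2) (Loc 𝔭)} :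
    g • stdLattice 𝔭 = stdLattice 𝔭 ↔
      (∀ i j, Valued.v (g.1 i j) ≤ 1) ∧ ∀ i j, Valued.v ((g⁻¹).1 i j) ≤ 1 := by
  rw [← smul_stdLattice_le, ← smul_stdLattice_le]
  constructor
  · intro h
    have h' : g⁻¹ • stdLattice 𝔭 = stdLattice 𝔭 := inv_smul_eq_iff.2 h.symm
    exact ⟨h.symm ▸ le_rfl, h'.symm ▸ le_rfl⟩
  · rintro ⟨h, h'⟩
    exact Lattice.smul_eq_of_le h h'

variable (𝔭) in
/-- The valuation of the determinant, written multiplicatively. -/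
def valDet : GL (Fin 2) (Loc 𝔭) →* WithZero (Multiplicative ℤ) where
  toFun g := Valued.v g.1.det
  map_one' := by simp
  map_mul' g h := by simp

theorem valDet_apply (g : GL (Fin 2) (Loc 𝔭)) : valDet 𝔭 g = Valued.v g.1.det := rfl

theorem valDet_inv (g : GL (Fin 2) (Loc 𝔭)) : valDet 𝔭 g⁻¹ = (valDet 𝔭 g)⁻¹ := by
  refine eq_inv_of_mul_eq_one_left ?_
  rw [← map_mul, inv_mul_cancel, map_one]

theorem valDet_ne_zero (g : GL (Fin 2) (Loc 𝔭)) : valDet 𝔭 g ≠ 0 := by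
  intro h
  have := map_mul (valDet 𝔭) g g⁻¹
  rw [h, zero_mul, mul_inv_cancel, map_one] at this
  exact one_ne_zero this

theorem valDet_scalar (c : (Loc 𝔭)ˣ) :
    valDet 𝔭 (GeneralLinearGroup.scalar (Fin 2) c) = Valued.v (c : Loc 𝔭) ^ 2 := by
  simp [valDet_apply, sq]

theorem valued_det_le_one {M : Matrix (Fin 2) (Fin 2) (Loc 𝔭)} (h : ∀ i j, Valued.v (M i j) ≤ 1) :
    Valued.v M.det ≤ 1 := by
  rw [Matrix.det_fin_two]
  exact (Valuation.map_sub _ _ _).trans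
    (max_le (valued_mul_le_one (h _ _) (h _ _)) (valued_mul_le_one (h _ _) (h _ _)))

/-- Both `g` and `g⁻¹` are integral, so both determinants have valuation at most one. -/
theorem valDet_eq_one {g : GL (Fin 2) (Loc 𝔭)} (h : g • stdLattice 𝔭 = stdLattice 𝔭) :
    valDet 𝔭 g = 1 := by
  rw [smul_stdLattice_eq] at h
  have h1 : valDet 𝔭 g ≤ 1 := valued_det_le_one h.1
  have h2 : valDet 𝔭 g⁻¹ ≤ 1 := valued_det_le_one h.2
  refine le_antisymm h1 ?_
  calc 1 = valDet 𝔭 g * valDet 𝔭 g⁻¹ := by rw [← map_mul, mul_inv_cancel, map_one]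
    _ ≤ valDet 𝔭 g * 1 := mul_le_mul_right h2 _
    _ = _ := mul_one _

/-- The diagonal matrix with entries `1`, `c`. -/
def diagOne (c : (Loc 𝔭)ˣ) : GL (Fin 2) (Loc 𝔭) :=
  ⟨!![1, 0; 0, c.1], !![1, 0; 0, c⁻¹.1], by simp [Matrix.one_fin_two], by simp [Matrix.one_fin_two]⟩

variable (𝔭) in
-- The two ends of the standard edge differ by a matrix whose determinant is a uniformizer; this is
-- the source of all the parity arguments.
theorem exists_uniformizer : ∃ c : (Loc 𝔭)ˣ, Valued.v (c : Loc 𝔭) = WithZero.exp (-1 : ℤ) ∧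
    diagOne c • stdLattice 𝔭 = stdLattice' 𝔭 := by
  obtain ⟨a, ha⟩ := 𝔭.valuation_exists_uniformizer F
  have hav : Valued.v (a : Loc 𝔭) = WithZero.exp (-1 : ℤ) := by
    rw [HeightOneSpectrum.valuedAdicCompletion_eq_valuation', ha]
  have ha0 : (a : Loc 𝔭) ≠ 0 := by
    intro h
    rw [h, map_zero] at hav
    exact WithZero.exp_ne_zero hav.symm
  -- The valuation is discrete: no value lies strictly between `exp (-1)` and `1`.
  have hlt : ∀ x : Loc 𝔭, Valued.v x < 1 ↔ Valued.v x ≤ WithZero.exp (-1 : ℤ) := by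
    intro x
    by_cases h0 : Valued.v x = 0
    · simp [h0]
    · rw [← WithZero.exp_log h0, ← WithZero.exp_zero, WithZero.exp_lt_exp, WithZero.exp_le_exp]
      omega
  refine ⟨Units.mk0 _ ha0, hav, Lattice.smul_eq_of_le ?_ ?_⟩
  · rintro _ ⟨x, hx, rfl⟩
    have hx' := mem_stdLattice.1 hx
    rw [mem_stdLattice', hlt]
    refine ⟨by simpa [diagOne, Matrix.mulVec, dotProduct, Fin.sum_univ_two] using hx'.1, ?_⟩
    have : Valued.v ((a : Loc 𝔭) * x 1) ≤ WithZero.exp (-1 : ℤ) := by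
      rw [map_mul, hav]
      exact mul_le_of_le_one_right' hx'.2
    simpa [diagOne, Matrix.mulVec, dotProduct, Fin.sum_univ_two] using this
  · rintro _ ⟨x, hx, rfl⟩
    have hx' := mem_stdLattice'.1 hx
    rw [hlt] at hx'
    rw [mem_stdLattice]
    refine ⟨by simpa [diagOne, Matrix.mulVec, dotProduct, Fin.sum_univ_two] using hx'.1, ?_⟩
    have : Valued.v ((a : Loc 𝔭)⁻¹ * x 1) ≤ 1 := by
      rw [map_mul, map_inv₀, hav]
      exact (inv_mul_le_one₀ (by simp)).2 hx'.2
    simpa [diagOne, Matrix.mulVec, dotProduct, Fin.sum_univ_two] using this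

/-! ### Homothety classes and the parity of the determinant. -/

theorem toVertex_eq_iff {L M : Lattice 𝔭} :
    L.toVertex = M.toVertex ↔ ∃ c : (Loc 𝔭)ˣ, GeneralLinearGroup.scalar (Fin 2) c • L = M :=
  Quotient.eq

theorem scalar_smul_toVertex (c : (Loc 𝔭)ˣ) (L : Lattice 𝔭) :
    (GeneralLinearGroup.scalar (Fin 2) c • L).toVertex = L.toVertex :=
  (toVertex_eq_iff.2 ⟨c, rfl⟩).symm

theorem scalar_smul_vertex (c : (Loc 𝔭)ˣ) (v : Vertex 𝔭) :
    GeneralLinearGroup.scalar (Fin 2) c • v = v := by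
  induction v using Quotient.ind with | _ L => exact scalar_smul_toVertex c L

theorem scalar_smul_edge (c : (Loc 𝔭)ˣ) (e : Edge 𝔭) :
    GeneralLinearGroup.scalar (Fin 2) c • e = e :=
  SimpleGraph.Dart.ext _ _ (Prod.ext (scalar_smul_vertex c _) (scalar_smul_vertex c _))

theorem smul_symm (g : GL (Fin 2) (Loc 𝔭)) (e : Edge 𝔭) : g • e.symm = (g • e).symm := rfl

theorem smul_fst (g : GL (Fin 2) (Loc 𝔭)) (e : Edge 𝔭) : (g • e).fst = g • e.fst := rfl

theorem smul_snd (g : GL (Fin 2) (Loc 𝔭)) (e : Edge 𝔭) : (g • e).snd = g • e.snd := rfl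

theorem edge_ext {e e' : Edge 𝔭} (h : e.fst = e'.fst) (h' : e.snd = e'.snd) : e = e' :=
  SimpleGraph.Dart.ext _ _ (Prod.ext h h')

theorem exists_scalar_of_smul_vertex {g : GL (Fin 2) (Loc 𝔭)}
    (h : g • (stdLattice 𝔭).toVertex = (stdLattice 𝔭).toVertex) :
    ∃ c : (Loc 𝔭)ˣ, (GeneralLinearGroup.scalar (Fin 2) c * g) • stdLattice 𝔭 = stdLattice 𝔭 := by
  obtain ⟨c, hc⟩ := toVertex_eq_iff.1 h
  exact ⟨c, by rw [mul_smul, hc]⟩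

/-- A scalar multiple of `g` fixes the lattice itself and has unit determinant, while a scalar
changes the determinant by a square. -/
theorem isSquare_valDet {g : GL (Fin 2) (Loc 𝔭)}
    (h : g • (stdLattice 𝔭).toVertex = (stdLattice 𝔭).toVertex) : IsSquare (valDet 𝔭 g) := by
  obtain ⟨c, hc⟩ := exists_scalar_of_smul_vertex h
  have := valDet_eq_one hc
  rw [map_mul, valDet_scalar] at this
  refine ⟨(Valued.v (c : Loc 𝔭))⁻¹, ?_⟩
  rw [eq_inv_of_mul_eq_one_right this]
  simp [sq]

theorem not_isSquare_exp_neg_one : ¬ IsSquare (WithZero.exp (-1 : ℤ)) := by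
  rintro ⟨x, hx⟩
  have h0 : x ≠ 0 := by
    rintro rfl
    simp at hx
  rw [← WithZero.exp_log h0, ← WithZero.exp_add, WithZero.exp_inj] at hx
  omega

/-- Modulo the stabilizer of the vertex, whose determinants are even, `g` is `diag(1, ϖ)`, whose
determinant is odd. -/
theorem not_isSquare_valDet {g : GL (Fin 2) (Loc 𝔭)}
    (h : g • (stdLattice 𝔭).toVertex = (stdLattice' 𝔭).toVertex) : ¬ IsSquare (valDet 𝔭 g) := by
  obtain ⟨ϖ, hϖ, hd⟩ := exists_uniformizer 𝔭
  intro hs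
  have h1 : ((diagOne ϖ)⁻¹ * g) • (stdLattice 𝔭).toVertex = (stdLattice 𝔭).toVertex := by
    rw [mul_smul, h, ← hd, ← smul_toVertex, inv_smul_smul]
  have h2 := (isSquare_valDet h1).mul hs.inv
  rw [map_mul, mul_assoc, mul_inv_cancel₀ (valDet_ne_zero g), mul_one, valDet_inv,
    isSquare_inv] at h2
  have h3 : valDet 𝔭 (diagOne ϖ) = WithZero.exp (-1 : ℤ) := by
    rw [← hϖ, valDet_apply]
    simp [diagOne]
  exact not_isSquare_exp_neg_one (h3 ▸ h2)

theorem isSquare_mul_of_not {x y : WithZero (Multiplicative ℤ)} (hx0 : x ≠ 0) (hy0 : y ≠ 0)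
    (hx : ¬ IsSquare x) (hy : ¬ IsSquare y) : IsSquare (x * y) := by
  have key : ∀ z : WithZero (Multiplicative ℤ), z ≠ 0 → ¬ IsSquare z →
      ∃ n : ℤ, z = WithZero.exp (2 * n + 1) := by
    intro z hz hs
    rcases Int.even_or_odd' (WithZero.log z) with ⟨n, hn | hn⟩
    · refine absurd ⟨WithZero.exp n, ?_⟩ hs
      rw [← WithZero.exp_add, ← two_mul, ← hn, WithZero.exp_log hz]
    · exact ⟨n, by rw [← hn, WithZero.exp_log hz]⟩
  obtain ⟨n, rfl⟩ := key x hx0 hx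
  obtain ⟨m, rfl⟩ := key y hy0 hy
  refine ⟨WithZero.exp (n + m + 1), ?_⟩
  rw [← WithZero.exp_add, ← WithZero.exp_add]
  congr 1
  ring

/-- An element of `GL₂(𝒪_𝔭)` fixing the class of `𝒪_𝔭 ⊕ 𝔭` is upper triangular modulo `𝔭`. -/
theorem valued_lower_left_lt_one {g : GL (Fin 2) (Loc 𝔭)} (h : g • stdLattice 𝔭 = stdLattice 𝔭)
    (h' : g • (stdLattice' 𝔭).toVertex = (stdLattice' 𝔭).toVertex) :
    Valued.v (g.1 1 0) < 1 := by
  obtain ⟨ϖ, hϖ, hd⟩ := exists_uniformizer 𝔭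
  obtain ⟨c, hc⟩ := toVertex_eq_iff.1 h'
  -- The homothety factor `c` is a unit: this conjugate of `c g` fixes the standard lattice, so its
  -- determinant, of valuation `v(c)² v(det g) = v(c)²`, is a unit.
  have h1 : ((diagOne ϖ)⁻¹ * (GeneralLinearGroup.scalar (Fin 2) c * g) * diagOne ϖ) • stdLattice 𝔭
      = stdLattice 𝔭 := by
    rw [mul_smul, hd, mul_smul, mul_smul, hc, ← hd, inv_smul_smul]
  have h2 := valDet_eq_one h1
  rw [map_mul, map_mul, map_mul, valDet_inv, valDet_eq_one h, mul_one, mul_right_comm,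
    inv_mul_cancel₀ (valDet_ne_zero _), one_mul, valDet_scalar,
    pow_eq_one_iff_of_nonneg zero_le two_ne_zero] at h2
  -- The image of the first basis vector is the first column of `g`; its second entry must therefore
  -- lie in `𝔭`.
  have h3 : (![1, 0] : Fin 2 → Loc 𝔭) ∈ (stdLattice' 𝔭).1 := by
    rw [mem_stdLattice']
    simp
  have h4 : act (GeneralLinearGroup.scalar (Fin 2) c) (act g ![1, 0]) ∈ (stdLattice' 𝔭).1 := by
    rw [← hc]
    exact ⟨_, ⟨_, h3, rfl⟩, rfl⟩
  have h5 := (mem_stdLattice'.1 h4).2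
  simpa [Matrix.mulVec_diagonal, Matrix.mulVec, dotProduct, Fin.sum_univ_two, h2,
    Matrix.diagonal_apply] using h5

theorem smul_stdLattice'_eq {g : GL (Fin 2) (Loc 𝔭)} (h : g • stdLattice 𝔭 = stdLattice 𝔭)
    (h1 : Valued.v (g.1 1 0) < 1) (h2 : Valued.v ((g⁻¹).1 1 0) < 1) :
    g • stdLattice' 𝔭 = stdLattice' 𝔭 := by
  have key : ∀ M : Matrix (Fin 2) (Fin 2) (Loc 𝔭), (∀ i j, Valued.v (M i j) ≤ 1) →
      Valued.v (M 1 0) < 1 → ∀ x ∈ (stdLattice' 𝔭).1, M *ᵥ x ∈ (stdLattice' 𝔭).1 := by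
    intro M hM hlt x hx
    rw [mem_stdLattice'] at hx ⊢
    simp only [Matrix.mulVec, dotProduct, Fin.sum_univ_two]
    refine ⟨valued_add_le_one (valued_mul_le_one (hM _ _) hx.1)
      (valued_mul_le_one (hM _ _) hx.2.le), (Valuation.map_add _ _ _).trans_lt (max_lt ?_ ?_)⟩
    · rw [map_mul]
      exact (mul_le_of_le_one_right' hx.1).trans_lt hlt
    · rw [map_mul]
      exact (mul_le_of_le_one_left' (hM _ _)).trans_lt hx.2
  rw [smul_stdLattice_eq] at h
  refine Lattice.smul_eq_of_le ?_ ?_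
  · rintro _ ⟨x, hx, rfl⟩
    exact key _ h.1 h1 x hx
  · rintro _ ⟨x, hx, rfl⟩
    exact key _ h.2 h2 x hx

/-! ### Transitivity -/

/-- A lattice over the principal ideal ring `𝒪_𝔭` is free of rank two, and the matrix with the
vectors of a basis as columns is the required `g`. -/
theorem exists_smul_stdLattice (L : Lattice 𝔭) :
    ∃ g : GL (Fin 2) (Loc 𝔭), g • stdLattice 𝔭 = L := by
  have hL : L.1.IsLattice (Loc 𝔭) := L.2
  have hfree : Module.Free (LocInt 𝔭) L.1 := Submodule.IsLattice.free (Loc 𝔭) L.1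
  have hfin : Module.Finite (LocInt 𝔭) L.1 := Module.Finite.iff_fg.2 hL.fg
  let b := Module.finBasisOfFinrankEq (LocInt 𝔭) L.1
    ((Submodule.IsLattice.finrank_of_pi (K := Loc 𝔭) (ι := Fin 2) L.1).trans (Fintype.card_fin 2))
  let M : Matrix (Fin 2) (Fin 2) (Loc 𝔭) := Matrix.of fun i j => (b j).1 i
  have hli : LinearIndependent (Loc 𝔭) M.col := by
    have := (b.extendOfIsLattice (Loc 𝔭)).linearIndependent
    have hcol : ⇑(b.extendOfIsLattice (Loc 𝔭)) = M.col :=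
      funext fun j => b.extendOfIsLattice_apply (Loc 𝔭) j
    rw [hcol] at this
    exact this
  have hdet : M.det ≠ 0 :=
    ((Matrix.isUnit_iff_isUnit_det M).1 (Matrix.linearIndependent_cols_iff_isUnit.1 hli)).ne_zero
  have hM : ∀ x : Fin 2 → LocInt 𝔭, M *ᵥ (fun i => (x i : Loc 𝔭))
      = ((x 0 • b 0 + x 1 • b 1 : L.1) : Fin 2 → Loc 𝔭) := by
    intro x
    funext i
    simp [M, Matrix.mulVec, dotProduct, Fin.sum_univ_two, Algebra.smul_def, mul_comm]
  refine ⟨GeneralLinearGroup.mkOfDetNeZero M hdet, Subtype.ext (le_antisymm ?_ ?_)⟩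
  · rintro _ ⟨x, hx, rfl⟩
    have hx' := mem_stdLattice.1 hx
    have h1 : x = fun i => ((![⟨x 0, hx'.1⟩, ⟨x 1, hx'.2⟩] i : LocInt 𝔭) : Loc 𝔭) := by
      funext i
      fin_cases i <;> rfl
    exact Set.mem_of_eq_of_mem ((congrArg (M *ᵥ ·) h1).trans (hM _)) (Subtype.coe_prop _)
  · intro y hy
    refine ⟨fun i => (b.repr ⟨y, hy⟩ i : Loc 𝔭), ?_, ?_⟩
    · exact mem_stdLattice.2 ⟨(b.repr ⟨y, hy⟩ 0).2, (b.repr ⟨y, hy⟩ 1).2⟩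
    · refine (hM fun i => b.repr ⟨y, hy⟩ i).trans ?_
      have := b.sum_repr ⟨y, hy⟩
      rw [Fin.sum_univ_two] at this
      exact congrArg Subtype.val this

/-- `GL₂(𝒪_𝔭)` acts transitively on the edges with source the class of `𝒪_𝔭 ⊕ 𝒪_𝔭`. -/
theorem exists_smul_stdEdge_of_fst {e : Edge 𝔭} (he : e.fst = (stdLattice 𝔭).toVertex) :
    ∃ g : GL (Fin 2) (Loc 𝔭), g • stdLattice 𝔭 = stdLattice 𝔭 ∧ g • stdEdge 𝔭 = e := by
  -- Adjacency is a symmetrized relation. In the case where the standard lattice is the smaller of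
  -- the two, the other is multiplied by a uniformizer, so that it lies below it.
  obtain ⟨S, hS, hmS, hSL⟩ : ∃ S : Lattice 𝔭, S.toVertex = e.snd ∧
      IsLocalRing.maximalIdeal (LocInt 𝔭) • (stdLattice 𝔭).1 ≤ S.1 ∧ S.1 ≤ (stdLattice 𝔭).1 := by
    have hadj : ∀ v w : Vertex 𝔭, (tree 𝔭).Adj v w → _ := fun v w h => by
      rw [tree, SimpleGraph.fromRel_adj] at h
      exact h.2
    rcases hadj _ _ e.adj with ⟨L', M, hL, hM, h⟩ | ⟨S, L', hS, hL, h⟩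
    · obtain ⟨c, hc⟩ := toVertex_eq_iff.1 (hL.trans he)
      obtain ⟨d, hd⟩ := exists_uniformizer_smul (𝔭 := 𝔭)
      have h' := smul_between (GeneralLinearGroup.scalar (Fin 2) c) h
      rw [hc] at h'
      refine ⟨GeneralLinearGroup.scalar (Fin 2) d • GeneralLinearGroup.scalar (Fin 2) c • M,
        by rw [scalar_smul_toVertex, scalar_smul_toVertex, hM], ?_, ?_⟩
      · rw [hd]; exact Submodule.smul_mono le_rfl h'.2
      · rw [hd]; exact h'.1
    · obtain ⟨c, hc⟩ := toVertex_eq_iff.1 (hL.trans he)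
      have h' := smul_between (GeneralLinearGroup.scalar (Fin 2) c) h
      rw [hc] at h'
      exact ⟨GeneralLinearGroup.scalar (Fin 2) c • S, by rw [scalar_smul_toVertex, hS], h'⟩
  have hne : S.toVertex ≠ (stdLattice 𝔭).toVertex := by
    rw [hS, ← he]
    exact e.adj.ne'
  have hsmall : ∀ x : Fin 2 → Loc 𝔭, Valued.v (x 0) < 1 → Valued.v (x 1) < 1 → x ∈
      IsLocalRing.maximalIdeal (LocInt 𝔭) • (stdLattice 𝔭).1 := by
    intro x h0 h1
    have e1 : (![1, 0] : Fin 2 → Loc 𝔭) ∈ (stdLattice 𝔭).1 := by rw [mem_stdLattice]; simp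
    have e2 : (![0, 1] : Fin 2 → Loc 𝔭) ∈ (stdLattice 𝔭).1 := by rw [mem_stdLattice]; simp
    have hx : x = (⟨x 0, h0.le⟩ : LocInt 𝔭) • ![1, 0] + (⟨x 1, h1.le⟩ : LocInt 𝔭) • ![0, 1] := by
      funext i
      fin_cases i <;> simp [Algebra.smul_def]
    rw [hx]
    exact add_mem
      (Submodule.smul_mem_smul (mem_maximalIdeal_iff_valued_lt_one.2 h0) e1)
      (Submodule.smul_mem_smul (mem_maximalIdeal_iff_valued_lt_one.2 h1) e2)
  -- Otherwise `S` would be `𝔭` times the standard lattice, which is the same vertex.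
  obtain ⟨x, hxS, hx⟩ : ∃ x ∈ S.1, ¬ (Valued.v (x 0) < 1 ∧ Valued.v (x 1) < 1) := by
    by_contra! hcon
    obtain ⟨d, hd⟩ := exists_uniformizer_smul (𝔭 := 𝔭)
    refine hne ?_
    have : S = GeneralLinearGroup.scalar (Fin 2) d • stdLattice 𝔭 := by
      refine Subtype.ext (le_antisymm ?_ ?_)
      · rw [hd]
        intro x hx
        have := hcon x hx
        exact hsmall x this.1 this.2
      · rw [hd]
        exact hmS
    rw [this, scalar_smul_toVertex]
  have hxL := mem_stdLattice.1 (hSL hxS)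
  -- One coordinate of `x` is a unit, so `x` is completed to a basis of `𝒪_𝔭²` by the standard
  -- vector of the other coordinate.
  obtain ⟨u, hu, hux⟩ : ∃ u : GL (Fin 2) (Loc 𝔭), u • stdLattice 𝔭 = stdLattice 𝔭 ∧
      u.1 *ᵥ ![1, 0] = x := by
    by_cases h0 : Valued.v (x 0) < 1
    · have h1 : Valued.v (x 1) = 1 := le_antisymm hxL.2 (not_lt.1 fun h => hx ⟨h0, h⟩)
      have h1' : x 1 ≠ 0 := by
        intro h
        simp [h] at h1
      refine ⟨⟨!![x 0, 1; x 1, 0], !![0, (x 1)⁻¹; 1, -x 0 * (x 1)⁻¹], ?_, ?_⟩, ?_, ?_⟩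
      · simp [Matrix.one_fin_two, h1']
      · simp [Matrix.one_fin_two, h1']
      · rw [smul_stdLattice_eq]
        refine ⟨fun i j => ?_, fun i j => ?_⟩
        · fin_cases i <;> fin_cases j <;> simp [h1, h0.le]
        · rw [Units.inv_mk]
          fin_cases i <;> fin_cases j <;> simp [h1, h0.le]
      · funext i
        fin_cases i <;> simp [Matrix.mulVec, dotProduct, Fin.sum_univ_two]
    · have h1 : Valued.v (x 0) = 1 := le_antisymm hxL.1 (not_lt.1 h0)
      have h1' : x 0 ≠ 0 := by
        intro h
        simp [h] at h1
      refine ⟨⟨!![x 0, 0; x 1, 1], !![(x 0)⁻¹, 0; -x 1 * (x 0)⁻¹, 1], ?_, ?_⟩, ?_, ?_⟩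
      · simp [Matrix.one_fin_two, h1']
      · simp [Matrix.one_fin_two, h1']
      · rw [smul_stdLattice_eq]
        refine ⟨fun i j => ?_, fun i j => ?_⟩
        · fin_cases i <;> fin_cases j <;> simp [h1, hxL.2]
        · rw [Units.inv_mk]
          fin_cases i <;> fin_cases j <;> simp [h1, hxL.2]
      · funext i
        fin_cases i <;> simp [Matrix.mulVec, dotProduct, Fin.sum_univ_two]
  refine ⟨u, hu, edge_ext (by rw [smul_fst, he]; exact congrArg Lattice.toVertex hu) ?_⟩
  rw [smul_snd, ← hS]
  change (u • stdLattice' 𝔭).toVertex = _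
  congr 1
  have hu' : u⁻¹ • stdLattice 𝔭 = stdLattice 𝔭 := inv_smul_eq_iff.2 hu.symm
  -- The lattice `T` contains `(1, 0)` and `𝔭 ⊕ 𝔭`, hence `𝒪_𝔭 ⊕ 𝔭`. It is no larger: a vector of
  -- `T` with unit second coordinate would force `T`, hence `S`, to be the standard lattice.
  set T := u⁻¹ • S with hT
  have hTL : T.1 ≤ (stdLattice 𝔭).1 := by
    have := Lattice.smul_mono u⁻¹ hSL
    rwa [hu'] at this
  have hmT : IsLocalRing.maximalIdeal (LocInt 𝔭) • (stdLattice 𝔭).1 ≤ T.1 := by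
    have := (smul_between u⁻¹ (L := S) (M := stdLattice 𝔭) ⟨hmS, hSL⟩).1
    rwa [hu'] at this
  have h10 : (![1, 0] : Fin 2 → Loc 𝔭) ∈ T.1 := by
    refine ⟨x, hxS, ?_⟩
    rw [← hux]
    change act u⁻¹ (act u _) = _
    rw [← LinearMap.comp_apply, ← act_mul, inv_mul_cancel, act_one]
    rfl
  have hfst : ∀ a : Loc 𝔭, Valued.v a ≤ 1 → (![a, 0] : Fin 2 → Loc 𝔭) ∈ T.1 := by
    intro a ha
    have := T.1.smul_mem (⟨a, ha⟩ : LocInt 𝔭) h10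
    convert this using 1
    funext i
    fin_cases i <;> simp [Algebra.smul_def]
  suffices hTe : T = stdLattice' 𝔭 by rw [← hTe, hT, smul_inv_smul]
  refine Subtype.ext (le_antisymm ?_ ?_)
  · intro y hy
    have hyL := mem_stdLattice.1 (hTL hy)
    rw [mem_stdLattice']
    refine ⟨hyL.1, lt_of_le_of_ne hyL.2 fun h1 => hne ?_⟩
    have hy0 : y 1 ≠ 0 := by
      intro h
      simp [h] at h1
    have h01 : (![0, 1] : Fin 2 → Loc 𝔭) ∈ T.1 := by
      have h2 := T.1.sub_mem hy (hfst _ hyL.1)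
      have h3 := T.1.smul_mem (⟨(y 1)⁻¹, by
        rw [HeightOneSpectrum.mem_adicCompletionIntegers, map_inv₀, h1, inv_one]⟩ : LocInt 𝔭) h2
      convert h3 using 1
      funext i
      fin_cases i <;> simp [Algebra.smul_def, hy0, Matrix.vecHead, Matrix.vecTail]
    have hTe : T = stdLattice 𝔭 := by
      refine Subtype.ext (le_antisymm hTL ?_)
      intro z hz
      have hz' := mem_stdLattice.1 hz
      have := T.1.add_mem (hfst _ hz'.1) (T.1.smul_mem (⟨z 1, hz'.2⟩ : LocInt 𝔭) h01)
      convert this using 1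
      funext i
      fin_cases i <;> simp [Algebra.smul_def]
    have : S = stdLattice 𝔭 := calc
      S = u • T := (smul_inv_smul u S).symm
      _ = stdLattice 𝔭 := by rw [hTe, hu]
    rw [this]
  · intro y hy
    have hy' := mem_stdLattice'.1 hy
    have h1 := T.1.add_mem (hfst _ hy'.1) (hmT (hsmall ![0, y 1] (by simp) (by simpa using hy'.2)))
    convert h1 using 1
    funext i
    fin_cases i <;> simp

theorem exists_smul_stdEdge (e : Edge 𝔭) : ∃ g : GL (Fin 2) (Loc 𝔭), g • stdEdge 𝔭 = e := by
  obtain ⟨L, hL⟩ : ∃ L : Lattice 𝔭, L.toVertex = e.fst := Quotient.exists_rep _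
  obtain ⟨g, rfl⟩ := exists_smul_stdLattice L
  obtain ⟨h, _, hh⟩ := exists_smul_stdEdge_of_fst (e := g⁻¹ • e) (by
    rw [smul_fst, ← hL, ← smul_toVertex, inv_smul_smul])
  exact ⟨g * h, by rw [mul_smul, hh, smul_inv_smul]⟩

end Local

/-! ### Adelic matrices and their local components -/

theorem not_le_of_isCoprime {F : Type*} [Field F] {𝔭 : HeightOneSpectrum (𝓞 F)}
    {𝔪 : Ideal (𝓞 F)} (h𝔪 : IsCoprime 𝔭.asIdeal 𝔪) : ¬ 𝔪 ≤ 𝔭.asIdeal := by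
  intro hle
  rw [Ideal.isCoprime_iff_sup_eq, sup_eq_left.2 hle] at h𝔪
  exact 𝔭.isPrime.ne_top h𝔪

section Adelic

variable {F : Type*} [Field F] [NumberField F]

theorem adelicMatrix_ext {A B : Matrix (Fin 2) (Fin 2) (FinAdeles F)}
    (h : ∀ v, A.map (localComp v) = B.map (localComp v)) : A = B := by
  refine Matrix.ext fun i j => FiniteAdeleRing.ext (K := F) fun v => ?_
  exact congrFun (congrFun (h v) i) j

theorem localGL_val (v : HeightOneSpectrum (𝓞 F)) (γ : GL2Fin F) :
    (localGL v γ).1 = γ.1.map (localComp v) := rfl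

theorem localGL_ext {γ δ : GL2Fin F} (h : ∀ v, localGL v γ = localGL v δ) : γ = δ :=
  Units.ext (adelicMatrix_ext fun v => congrArg Units.val (h v))

open Classical in
/-- The adelic matrix with component `M` at `𝔭` and component `1` elsewhere. -/
def adelicMatrix {𝔭 : HeightOneSpectrum (𝓞 F)} (M : Matrix (Fin 2) (Fin 2) (Loc 𝔭)) :
    Matrix (Fin 2) (Fin 2) (FinAdeles F) :=
  Matrix.of fun i j => ⟨Function.update
    (fun v => (1 : Matrix (Fin 2) (Fin 2) (v.adicCompletion F)) i j) 𝔭 (M i j), by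
      refine Set.Finite.subset (Set.finite_singleton 𝔭) fun v hv => ?_
      by_contra hne
      refine hv ?_
      change Function.update _ _ _ v ∈ v.adicCompletionIntegers F
      rw [Function.update_of_ne hne]
      by_cases hij : i = j
      · subst hij
        simp
      · simp [Matrix.one_apply_ne hij]⟩

theorem adelicMatrix_map_self {𝔭 : HeightOneSpectrum (𝓞 F)} (M : Matrix (Fin 2) (Fin 2) (Loc 𝔭)) :
    (adelicMatrix M).map (localComp 𝔭) = M := by
  classical
  refine Matrix.ext fun i j => ?_
  exact Function.update_self (f := fun v : HeightOneSpectrum (𝓞 F) =>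
    (1 : Matrix (Fin 2) (Fin 2) (v.adicCompletion F)) i j) 𝔭 (M i j)

theorem adelicMatrix_map_of_ne {𝔭 v : HeightOneSpectrum (𝓞 F)} (hv : v ≠ 𝔭)
    (M : Matrix (Fin 2) (Fin 2) (Loc 𝔭)) : (adelicMatrix M).map (localComp v) = 1 := by
  classical
  refine Matrix.ext fun i j => ?_
  exact Function.update_of_ne (f := fun v : HeightOneSpectrum (𝓞 F) =>
    (1 : Matrix (Fin 2) (Fin 2) (v.adicCompletion F)) i j) hv (M i j)

theorem adelicMatrix_mul_eq_one {𝔭 : HeightOneSpectrum (𝓞 F)}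
    {M N : Matrix (Fin 2) (Fin 2) (Loc 𝔭)} (h : M * N = 1) :
    adelicMatrix M * adelicMatrix N = 1 := by
  refine adelicMatrix_ext fun v => ?_
  rw [Matrix.map_mul, Matrix.map_one _ (map_zero _) (map_one _)]
  by_cases hv : v = 𝔭
  · subst hv
    rw [adelicMatrix_map_self, adelicMatrix_map_self, h]
  · rw [adelicMatrix_map_of_ne hv, adelicMatrix_map_of_ne hv, one_mul]

/-- Transfers the local transitivity statements to adelic groups: the conditions away from `𝔭` hold
trivially for the identity. -/
theorem exists_localGL_eq {𝔭 : HeightOneSpectrum (𝓞 F)} (g : GL (Fin 2) (Loc 𝔭)) :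
    ∃ γ : GL2Fin F, localGL 𝔭 γ = g ∧ ∀ v, v ≠ 𝔭 → localGL v γ = 1 :=
  ⟨⟨adelicMatrix g.1, adelicMatrix (g⁻¹).1,
    adelicMatrix_mul_eq_one (by rw [← Units.val_mul, mul_inv_cancel, Units.val_one]),
    adelicMatrix_mul_eq_one (by rw [← Units.val_mul, inv_mul_cancel, Units.val_one])⟩,
    Units.ext (adelicMatrix_map_self _), fun _ hv => Units.ext (adelicMatrix_map_of_ne hv _)⟩

theorem localGL_scalar (v : HeightOneSpectrum (𝓞 F)) (a : (FinAdeles F)ˣ) :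
    localGL v (GeneralLinearGroup.scalar (Fin 2) a)
      = GeneralLinearGroup.scalar (Fin 2) (Units.map (localComp v).toMonoidHom a) := by
  refine Units.ext (Matrix.ext fun i j => ?_)
  fin_cases i <;> fin_cases j <;> simp [localGL_val]

theorem exists_localGL_eq_scalar {z : GL2Fin F} (hz : z ∈ Subgroup.center (GL2Fin F))
    (v : HeightOneSpectrum (𝓞 F)) :
    ∃ c : (v.adicCompletion F)ˣ, localGL v z = GeneralLinearGroup.scalar (Fin 2) c := by
  rw [GeneralLinearGroup.center_eq_range_scalar] at hz
  obtain ⟨a, rfl⟩ := hz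
  exact ⟨_, localGL_scalar v a⟩

theorem mem_center_of_local {z : GL2Fin F}
    (h : ∀ v, ∃ c : (v.adicCompletion F)ˣ, localGL v z = GeneralLinearGroup.scalar (Fin 2) c) :
    z ∈ Subgroup.center (GL2Fin F) := by
  rw [Subgroup.mem_center_iff]
  refine fun g => localGL_ext fun v => ?_
  obtain ⟨c, hc⟩ := h v
  rw [map_mul, map_mul, hc, GeneralLinearGroup.scalar_commute]

theorem toPGL_surjective : Function.Surjective (toPGL (F := F)) :=
  QuotientGroup.mk'_surjective _

theorem toPGL_eq_iff {γ δ : GL2Fin F} :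
    toPGL γ = toPGL δ ↔ ∃ z ∈ Subgroup.center (GL2Fin F), δ = γ * z := by
  refine QuotientGroup.eq.trans ⟨fun h => ⟨_, h, by simp⟩, ?_⟩
  rintro ⟨z, hz, rfl⟩
  simpa using hz

/-- Central elements are scalar at `𝔭` and scalars fix every edge, so the action on edges descends
to `PGL₂`. -/
theorem localGL_smul_edge_congr {𝔭 : HeightOneSpectrum (𝓞 F)} {γ δ : GL2Fin F}
    (h : toPGL γ = toPGL δ) (e : Edge 𝔭) : localGL 𝔭 γ • e = localGL 𝔭 δ • e := by
  obtain ⟨z, hz, rfl⟩ := toPGL_eq_iff.1 h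
  obtain ⟨c, hc⟩ := exists_localGL_eq_scalar hz 𝔭
  rw [map_mul, mul_smul, hc, scalar_smul_edge]

/-! ### The groups `Ω₀(𝔫)` and `Ω` -/

theorem smul_stdLattice_of_mem_localOrder {𝔫 : Ideal (𝓞 F)} {v : HeightOneSpectrum (𝓞 F)}
    {γ : GL2Fin F}
    (h : (localGL v γ).1 ∈ localOrder 𝔫 v ∧ (localGL v γ⁻¹).1 ∈ localOrder 𝔫 v) :
    localGL v γ • stdLattice v = stdLattice v := by
  rw [smul_stdLattice_eq, ← map_inv]
  exact ⟨h.1.1, h.2.1⟩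

theorem mem_localOrder_of_not_le {𝔫 : Ideal (𝓞 F)} {v : HeightOneSpectrum (𝓞 F)}
    (h : ¬ 𝔫 ≤ v.asIdeal) {M : Matrix (Fin 2) (Fin 2) (v.adicCompletion F)}
    (hM : ∀ i j, Valued.v (M i j) ≤ 1) : M ∈ localOrder 𝔫 v :=
  ⟨hM, ⟨M 1 0, hM 1 0⟩, by rw [map_eq_top_of_not_le h]; trivial, rfl⟩

theorem localOrder_mono {𝔫 𝔫' : Ideal (𝓞 F)} (h : 𝔫 ≤ 𝔫') (v : HeightOneSpectrum (𝓞 F)) :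
    localOrder 𝔫 v ≤ localOrder 𝔫' v := by
  rintro M ⟨hM, c, hc, hc'⟩
  exact ⟨hM, c, Ideal.map_mono h hc, hc'⟩

theorem Omega0_mono {𝔫 𝔫' : Ideal (𝓞 F)} (h : 𝔫 ≤ 𝔫') : Omega0 𝔫 ≤ Omega0 𝔫' :=
  fun _ hγ v hv => ⟨localOrder_mono h v (hγ v hv).1, localOrder_mono h v (hγ v hv).2⟩

theorem valued_lower_left_of_mem_localOrder {𝔫 : Ideal (𝓞 F)} {v : HeightOneSpectrum (𝓞 F)}
    (h : 𝔫 ≤ v.asIdeal) {M : Matrix (Fin 2) (Fin 2) (v.adicCompletion F)}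
    (hM : M ∈ localOrder 𝔫 v) : Valued.v (M 1 0) < 1 := by
  obtain ⟨-, c, hc, hc'⟩ := hM
  rw [← hc', ← mem_maximalIdeal_iff_valued_lt_one]
  refine (Ideal.map_le_iff_le_comap.2 fun a ha => ?_ : 𝔫.map _ ≤ _) hc
  rw [Ideal.mem_comap, mem_maximalIdeal_iff_valued_lt_one]
  change Valued.v ((algebraMap (𝓞 F) F a : F) : v.adicCompletion F) < 1
  rw [HeightOneSpectrum.valuedAdicCompletion_eq_valuation',
    HeightOneSpectrum.valuation_lt_one_iff_mem]
  exact h ha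

variable {p : ℕ} {𝔭 : HeightOneSpectrum (𝓞 F)} {𝔪 : Ideal (𝓞 F)}

/-- Parity needs checking at `𝔭` only: at any other prime above `p` the component is integral with
integral inverse, so its determinant is a unit. -/
theorem toPGL_mem_Omega {γ : GL2Fin F} (h : γ ∈ localUnits 𝔪 {v | v ≠ 𝔭})
    (hs : IsSquare (valDet 𝔭 (localGL 𝔭 γ))) : toPGL γ ∈ Omega p 𝔭 𝔪 := by
  refine ⟨⟨γ, fun v _ => ?_, rfl⟩, ⟨γ, h, rfl⟩⟩
  by_cases hv : v = 𝔭
  · subst hv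
    exact hs
  · have := valDet_eq_one (smul_stdLattice_of_mem_localOrder (h v hv))
    rw [valDet_apply] at this
    rw [this]
    exact IsSquare.one

/-- Another representative of the class differs by a scalar at `𝔭`, which changes the determinant by
a square. -/
theorem isSquare_of_mem_Omega (h𝔭 : (p : 𝓞 F) ∈ 𝔭.asIdeal) {γ : GL2Fin F}
    (h : toPGL γ ∈ Omega p 𝔭 𝔪) : IsSquare (valDet 𝔭 (localGL 𝔭 γ)) := by
  obtain ⟨δ, hδ, hδγ⟩ := h.1
  obtain ⟨z, hz, rfl⟩ := toPGL_eq_iff.1 hδγ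
  obtain ⟨c, hc⟩ := exists_localGL_eq_scalar hz 𝔭
  rw [map_mul, map_mul, hc, valDet_scalar]
  exact (hδ 𝔭 h𝔭).mul (IsSquare.sq _)

theorem mem_localUnits_of_eq_one {γ : GL2Fin F} (h : ∀ v, v ≠ 𝔭 → localGL v γ = 1) :
    γ ∈ localUnits 𝔪 {v | v ≠ 𝔭} := by
  intro v hv
  rw [map_inv, h v hv, inv_one]
  exact ⟨one_mem _, one_mem _⟩

theorem toPGL_mem_Omega_of_mem_Omega0 {γ : GL2Fin F} (h : γ ∈ Omega0 𝔪) :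
    toPGL γ ∈ Omega p 𝔭 𝔪 := by
  refine toPGL_mem_Omega (fun v _ => h v trivial) ?_
  rw [valDet_eq_one (smul_stdLattice_of_mem_localOrder (h 𝔭 trivial))]
  exact IsSquare.one

theorem smul_stdEdge_of_mem_Omega0_mul {γ : GL2Fin F} (h : γ ∈ Omega0 (𝔭.asIdeal * 𝔪)) :
    localGL 𝔭 γ • stdEdge 𝔭 = stdEdge 𝔭 := by
  have h1 := smul_stdLattice_of_mem_localOrder (h 𝔭 trivial)
  have hle : 𝔭.asIdeal * 𝔪 ≤ 𝔭.asIdeal := Ideal.mul_le_left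
  have h2 := smul_stdLattice'_eq h1 (valued_lower_left_of_mem_localOrder hle (h 𝔭 trivial).1)
    (by
      rw [← map_inv]
      exact valued_lower_left_of_mem_localOrder hle (h 𝔭 trivial).2)
  exact edge_ext (congrArg Lattice.toVertex h1) (congrArg Lattice.toVertex h2)

/-- By coprimality, the levels `𝔪` and `𝔭𝔪` differ only at `𝔭`, where the extra condition, a lower
left entry in `𝔭`, expresses that the second end of the edge is fixed. -/
theorem mem_Omega0_mul_of_smul_stdEdge (h𝔪 : IsCoprime 𝔭.asIdeal 𝔪) {γ : GL2Fin F}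
    (h : γ ∈ Omega0 𝔪) (he : localGL 𝔭 γ • stdEdge 𝔭 = stdEdge 𝔭) :
    γ ∈ Omega0 (𝔭.asIdeal * 𝔪) := by
  have key : ∀ δ ∈ Omega0 𝔪, localGL 𝔭 δ • stdEdge 𝔭 = stdEdge 𝔭 →
      ∀ v, (localGL v δ).1 ∈ localOrder (𝔭.asIdeal * 𝔪) v := by
    intro δ hδ hδe v
    refine mem_localOrder_mul h𝔪 (hδ v trivial).1 ?_
    rintro rfl
    have := valued_lower_left_lt_one (smul_stdLattice_of_mem_localOrder (hδ v trivial))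
      (congrArg (fun e : Edge v => e.snd) hδe)
    exact ⟨⟨_, this.le⟩, mem_maximalIdeal_iff_valued_lt_one.2 this, rfl⟩
  refine fun v _ => ⟨key γ h he v, key γ⁻¹ (inv_mem h) ?_ v⟩
  rw [map_inv, inv_smul_eq_iff, he]

/-- The stabilizer of the standard edge in `Ω` is the image of `Ω₀(𝔭𝔪)`. -/
theorem exists_mem_Omega0_mul_of_smul_stdEdge (h𝔪 : IsCoprime 𝔭.asIdeal 𝔪) {γ : GL2Fin F}
    (h : toPGL γ ∈ Omega p 𝔭 𝔪) (he : localGL 𝔭 γ • stdEdge 𝔭 = stdEdge 𝔭) :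
    ∃ u ∈ Omega0 (𝔭.asIdeal * 𝔪), toPGL u = toPGL γ := by
  obtain ⟨δ, hδ, hδγ⟩ := h.2
  rw [← localGL_smul_edge_congr hδγ] at he
  obtain ⟨c, hc⟩ := exists_scalar_of_smul_vertex (congrArg (fun e : Edge 𝔭 => e.fst) he)
  -- The scalar making the component at `𝔭` integral is inserted at `𝔭` alone. It is central in the
  -- adelic group, so the class in `PGL₂` does not change.
  obtain ⟨z, hz, hz1⟩ := exists_localGL_eq (GeneralLinearGroup.scalar (Fin 2) c)
  have hzc : z ∈ Subgroup.center (GL2Fin F) := by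
    refine mem_center_of_local fun v => ?_
    by_cases hv : v = 𝔭
    · subst hv
      exact ⟨c, hz⟩
    · exact ⟨1, by rw [hz1 v hv, map_one]⟩
  have hu : toPGL δ = toPGL (z * δ) :=
    toPGL_eq_iff.2 ⟨z, hzc, ((Subgroup.mem_center_iff.1 hzc) δ).symm⟩
  refine ⟨z * δ, mem_Omega0_mul_of_smul_stdEdge h𝔪 (fun v _ => ?_) ?_, hu ▸ hδγ⟩
  · by_cases hv : v = 𝔭
    · subst hv
      rw [← hz, ← map_mul, smul_stdLattice_eq, ← map_inv] at hc
      exact ⟨mem_localOrder_of_not_le (not_le_of_isCoprime h𝔪) hc.1,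
        mem_localOrder_of_not_le (not_le_of_isCoprime h𝔪) hc.2⟩
    · have := hδ v hv
      rw [map_inv] at this ⊢
      rw [map_mul, hz1 v hv, one_mul]
      exact this
  · rw [← localGL_smul_edge_congr hu, he]

theorem exists_mem_Omega0_smul_stdEdge (h𝔪 : IsCoprime 𝔭.asIdeal 𝔪) {e : Edge 𝔭}
    (he : e.fst = (stdLattice 𝔭).toVertex) :
    ∃ γ ∈ Omega0 𝔪, localGL 𝔭 γ • stdEdge 𝔭 = e := by
  obtain ⟨g, hg, hge⟩ := exists_smul_stdEdge_of_fst he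
  obtain ⟨γ, rfl, hγ⟩ := exists_localGL_eq g
  refine ⟨γ, fun v _ => ?_, hge⟩
  by_cases hv : v = 𝔭
  · subst hv
    rw [smul_stdLattice_eq, ← map_inv] at hg
    exact ⟨mem_localOrder_of_not_le (not_le_of_isCoprime h𝔪) hg.1,
      mem_localOrder_of_not_le (not_le_of_isCoprime h𝔪) hg.2⟩
  · exact mem_localUnits_of_eq_one hγ v hv

/-- Reversing the edge requires odd determinant. This lets signs be assigned consistently when a
form is extended to the tree. -/
theorem smul_stdEdge_ne_symm (h𝔭 : (p : 𝓞 F) ∈ 𝔭.asIdeal) {γ : GL2Fin F}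
    (h : toPGL γ ∈ Omega p 𝔭 𝔪) : localGL 𝔭 γ • stdEdge 𝔭 ≠ (stdEdge 𝔭).symm := fun he =>
  not_isSquare_valDet (congrArg (fun e : Edge 𝔭 => e.fst) he) (isSquare_of_mem_Omega h𝔭 h)

/-! ### Orbits of `Ω` on edges and vertices. -/

variable {α : GL2Fin F}

/-- Up to orientation, `Ω` acts transitively on the edges. -/
theorem exists_mem_Omega_smul_stdEdge (hα : IsAtkinLehner 𝔭 α) (e : Edge 𝔭) :
    ∃ γ : GL2Fin F, toPGL γ ∈ Omega p 𝔭 𝔪 ∧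
      (localGL 𝔭 γ • stdEdge 𝔭 = e ∨ localGL 𝔭 γ • stdEdge 𝔭 = e.symm) := by
  obtain ⟨g, hg⟩ := exists_smul_stdEdge e
  obtain ⟨γ, rfl, hγ⟩ := exists_localGL_eq g
  by_cases hs : IsSquare (valDet 𝔭 (localGL 𝔭 γ))
  · exact ⟨γ, toPGL_mem_Omega (mem_localUnits_of_eq_one hγ) hs, Or.inl hg⟩
  -- Here `γ` has odd determinant, and so does `α`; the product is even, and it reaches `e` with the
  -- opposite orientation.
  · refine ⟨γ * α, toPGL_mem_Omega (mem_localUnits_of_eq_one fun v hv => ?_) ?_, Or.inr ?_⟩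
    · rw [map_mul, hγ v hv, hα.1 v hv, one_mul]
    · rw [map_mul, map_mul]
      exact isSquare_mul_of_not (valDet_ne_zero _) (valDet_ne_zero _) hs
        (not_isSquare_valDet (congrArg (fun e : Edge 𝔭 => e.fst) hα.2))
    · rw [map_mul, mul_smul, hα.2, smul_symm, hg]

theorem exists_mem_Omega_smul_vertex (hα : IsAtkinLehner 𝔭 α) (v : Vertex 𝔭) :
    ∃ γ : GL2Fin F, toPGL γ ∈ Omega p 𝔭 𝔪 ∧
      (localGL 𝔭 γ • (stdLattice 𝔭).toVertex = v ∨ localGL 𝔭 γ • (stdLattice' 𝔭).toVertex = v) := by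
  obtain ⟨L, rfl⟩ : ∃ L : Lattice 𝔭, L.toVertex = v := Quotient.exists_rep v
  obtain ⟨g, rfl⟩ := exists_smul_stdLattice L
  obtain ⟨γ, hγ, h | h⟩ := exists_mem_Omega_smul_stdEdge (p := p) (𝔪 := 𝔪) hα (g • stdEdge 𝔭)
  · exact ⟨γ, hγ, Or.inl (congrArg (fun e : Edge 𝔭 => e.fst) h)⟩
  · exact ⟨γ, hγ, Or.inr (congrArg (fun e : Edge 𝔭 => e.snd) h)⟩

/-- Conjugation by `α` changes neither the components away from `𝔭` nor the determinant. These
conjugates move `e_*` among the edges ending at its target. -/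
theorem conj_mem_Omega (hα : IsAtkinLehner 𝔭 α) {γ : GL2Fin F} (h : γ ∈ Omega0 𝔪) :
    toPGL (α⁻¹ * γ * α) ∈ Omega p 𝔭 𝔪 := by
  refine toPGL_mem_Omega (fun v hv => ?_) ?_
  · have := h v trivial
    rw [map_inv] at this ⊢
    rwa [map_mul, map_mul, map_inv, hα.1 v hv, inv_one, one_mul, mul_one]
  · rw [map_mul, map_mul, map_mul, map_mul, mul_right_comm, ← map_mul, ← map_mul, map_inv,
      inv_mul_cancel, one_mul, valDet_eq_one (smul_stdLattice_of_mem_localOrder (h 𝔭 trivial))]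
    exact IsSquare.one

end Adelic

/-! ### Sums over the star of a vertex -/

section Stars

variable {F : Type*} [Field F] [NumberField F] {𝔭 : HeightOneSpectrum (𝓞 F)} {𝔪 : Ideal (𝓞 F)}
  {V : Type*} [AddCommMonoid V]

theorem finsum_fst_smul (δ : GL (Fin 2) (Loc 𝔭)) (v : Vertex 𝔭) (Φ : Edge 𝔭 → V) :
    ∑ᶠ e ∈ {e : Edge 𝔭 | e.fst = δ • v}, Φ e = ∑ᶠ e ∈ {e : Edge 𝔭 | e.fst = v}, Φ (δ • e) := by
  rw [← finsum_mem_image (MulAction.injective δ).injOn]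
  congr! 3 with e
  refine ⟨fun h => ⟨δ⁻¹ • e, ?_, smul_inv_smul δ e⟩, ?_⟩
  · exact inv_smul_eq_iff.2 h
  · rintro ⟨e, rfl, rfl⟩
    rfl

theorem finsum_snd_eq (v : Vertex 𝔭) (Φ : Edge 𝔭 → V) :
    ∑ᶠ e ∈ {e : Edge 𝔭 | e.snd = v}, Φ e = ∑ᶠ e ∈ {e : Edge 𝔭 | e.fst = v}, Φ e.symm := by
  rw [← finsum_mem_image (f := Φ) (g := fun e : Edge 𝔭 => e.symm)
    SimpleGraph.Dart.symm_involutive.injective.injOn]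
  congr! 3 with e
  refine ⟨fun h => ⟨e.symm, h, SimpleGraph.Dart.symm_symm e⟩, ?_⟩
  rintro ⟨e, rfl, rfl⟩
  rfl

/-- The cosets of `Ω₀(𝔭𝔪)` in `Ω₀(𝔪)` correspond to the edges with source `[𝒪_𝔭 ⊕ 𝒪_𝔭]`. -/
theorem finsum_levelCosets (h𝔪 : IsCoprime 𝔭.asIdeal 𝔪) (Φ : Edge 𝔭 → V) :
    ∑ᶠ x : LevelCosets 𝔭 𝔪, Φ (localGL 𝔭 x.out.1 • stdEdge 𝔭)
      = ∑ᶠ e ∈ {e : Edge 𝔭 | e.fst = (stdLattice 𝔭).toVertex}, Φ e := by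
  have hinj : Function.Injective
      fun x : LevelCosets 𝔭 𝔪 => localGL 𝔭 x.out.1 • stdEdge 𝔭 := by
    intro x y h
    rw [← x.out_eq, ← y.out_eq]
    refine QuotientGroup.eq.2 ?_
    rw [Subgroup.mem_subgroupOf]
    refine mem_Omega0_mul_of_smul_stdEdge h𝔪 (x.out⁻¹ * y.out).2 ?_
    rw [Subgroup.coe_mul, Subgroup.coe_inv, map_mul, map_inv, mul_smul, inv_smul_eq_iff]
    exact h.symm
  rw [← finsum_mem_range hinj]
  congr! 3 with e
  refine ⟨?_, fun he => ?_⟩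
  · rintro ⟨x, rfl⟩
    exact congrArg Lattice.toVertex (smul_stdLattice_of_mem_localOrder (x.out.2 𝔭 trivial))
  · obtain ⟨γ, hγ, rfl⟩ := exists_mem_Omega0_smul_stdEdge h𝔪 he
    refine ⟨QuotientGroup.mk ⟨γ, hγ⟩, ?_⟩
    -- The chosen representative of the coset differs from `γ` by an element of `Ω₀(𝔭𝔪)`, which
    -- fixes the standard edge.
    obtain ⟨u, hu⟩ := QuotientGroup.mk_out_eq_mul
      ((Omega0 (𝔭.asIdeal * 𝔪)).subgroupOf (Omega0 𝔪)) ⟨γ, hγ⟩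
    change localGL 𝔭 (Quotient.out _ : Omega0 𝔪).1 • stdEdge 𝔭 = _
    rw [hu, Subgroup.coe_mul, map_mul, mul_smul,
      smul_stdEdge_of_mem_Omega0_mul (Subgroup.mem_subgroupOf.1 u.2)]

theorem IsAtkinLehner.smul_stdLattice' {α : GL2Fin F} (hα : IsAtkinLehner 𝔭 α) :
    localGL 𝔭 α • (stdLattice' 𝔭).toVertex = (stdLattice 𝔭).toVertex :=
  congrArg (fun e : Edge 𝔭 => e.snd) hα.2

/-- Since `α` reverses `e_*`, the edge `α⁻¹γα e_*` is the reverse of `α⁻¹(γ e_*)`, and `α⁻¹` carries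
the edges leaving the source of `e_*` to those leaving its target. -/
theorem finsum_levelCosets_symm (h𝔪 : IsCoprime 𝔭.asIdeal 𝔪) {α : GL2Fin F}
    (hα : IsAtkinLehner 𝔭 α) (Φ : Edge 𝔭 → V) :
    ∑ᶠ x : LevelCosets 𝔭 𝔪, Φ (localGL 𝔭 (α⁻¹ * x.out.1 * α) • stdEdge 𝔭)
      = ∑ᶠ e ∈ {e : Edge 𝔭 | e.snd = (stdLattice' 𝔭).toVertex}, Φ e := by
  have h1 : ∀ γ : GL2Fin F, localGL 𝔭 (α⁻¹ * γ * α) • stdEdge 𝔭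
      = ((localGL 𝔭 α)⁻¹ • (localGL 𝔭 γ • stdEdge 𝔭)).symm := by
    intro γ
    rw [map_mul, map_mul, map_inv, mul_smul, mul_smul, hα.2]
    rfl
  simp only [h1]
  rw [finsum_levelCosets h𝔪 fun e => Φ ((localGL 𝔭 α)⁻¹ • e).symm, finsum_snd_eq,
    ← inv_smul_eq_iff.2 hα.smul_stdLattice'.symm, finsum_fst_smul]

end Stars

/-! ### Operations on cusp forms -/

section CuspForms

variable {F : Type*} [Field F] [NumberField F] {σ : F →+* ℂ} {k : ℕ}

/-- Right translation at the finite places commutes with the left actions of `GL₂(F)` and the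
unipotents, and with everything at infinity; only the level is affected. -/
theorem IsCuspForm.translate {U U' : Subgroup (GL2Fin F)} {f : GL2Adele F → WeightSpace k}
    (hf : IsCuspForm σ k U f) (γ : GL2Fin F)
    (hU : ∀ (g : GL2Adele F), ∀ u ∈ U', f (g.1, g.2 * u * γ) = f (g.1, g.2 * γ)) :
    IsCuspForm σ k U' fun g => f (g.1, g.2 * γ) where
  weight g := hf.weight (g.1, g.2 * γ)
  level := hU
  automorphic δ g := by
    rw [mul_assoc]
    exact hf.automorphic δ (g.1, g.2 * γ)
  smooth h := hf.smooth (h * γ)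
  eigen c hc h := hf.eigen c hc (h * γ)
  cuspidal μ hμ g d := by
    have := hf.cuspidal μ hμ (g.1, g.2 * γ) d
    simp only [← mul_assoc] at this
    exact this

theorem IsCuspForm.change_level {U U' : Subgroup (GL2Fin F)} {f : GL2Adele F → WeightSpace k}
    (hf : IsCuspForm σ k U f) (hU : ∀ (g : GL2Adele F), ∀ u ∈ U', f (g.1, g.2 * u) = f g) :
    IsCuspForm σ k U' f :=
  { hf with level := hU }

theorem mem_cuspFormsPGL {U : Subgroup (GL2Fin F)} {f : PGL2f F → WeightSpace k} :
    f ∈ cuspFormsPGL σ k U ↔ IsCuspForm σ k U fun g => f (g.1, toPGL g.2) := Iff.rfl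

theorem cuspFormsPGL_level {U : Subgroup (GL2Fin F)} {f : PGL2f F → WeightSpace k}
    (hf : f ∈ cuspFormsPGL σ k U) {u : GL2Fin F} (hu : u ∈ U) (g : PGL2f F) :
    f (g.1, g.2 * toPGL u) = f g := by
  obtain ⟨x, y⟩ := g
  obtain ⟨y, rfl⟩ := toPGL_surjective y
  rw [← map_mul]
  exact (mem_cuspFormsPGL.1 hf).level (x, y) u hu

end CuspForms

/-! ### Restriction of forms on the tree to the standard edge -/

section Restriction

variable {F : Type*} [Field F] [NumberField F] {σ : F →+* ℂ} {p : ℕ} {k : ℕ}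
  {𝔭 : HeightOneSpectrum (𝓞 F)} {𝔪 : Ideal (𝓞 F)} {α : GL2Fin F}
  {Φ : Edge 𝔭 → PGL2f F → WeightSpace k}

theorem treeForms_smul (hΦ : Φ ∈ treeForms σ p 𝔭 𝔪 k) {γ : GL2Fin F}
    (hγ : toPGL γ ∈ Omega p 𝔭 𝔪) (e : Edge 𝔭) (g : PGL2f F) :
    Φ (localGL 𝔭 γ • e) g = Φ e (g.1, g.2 * toPGL γ) := by
  rw [← hΦ.1 γ hγ e (g.1, g.2 * toPGL γ), mul_inv_cancel_right]

theorem treeForms_stdEdge_mem_newForms (h𝔪 : IsCoprime 𝔭.asIdeal 𝔪) (hα : IsAtkinLehner 𝔭 α)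
    (hΦ : Φ ∈ treeForms σ p 𝔭 𝔪 k) : Φ (stdEdge 𝔭) ∈ newForms σ 𝔭 𝔪 h𝔪 α k := by
  refine ⟨IsCuspForm.change_level (hΦ.2.2 (stdEdge 𝔭)) fun g u hu => ?_, ?_, ?_⟩
  · refine (hΦ.2.2 (stdEdge 𝔭)).level g u ⟨?_, smul_stdEdge_of_mem_Omega0_mul hu⟩
    exact toPGL_mem_Omega_of_mem_Omega0 (Omega0_mono Ideal.mul_le_right hu)
  · funext g
    calc degS 𝔭 𝔪 (Φ (stdEdge 𝔭)) g
        = ∑ᶠ x : LevelCosets 𝔭 𝔪, Φ (localGL 𝔭 x.out.1 • stdEdge 𝔭) g :=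
          finsum_congr fun x =>
            (treeForms_smul hΦ (toPGL_mem_Omega_of_mem_Omega0 x.out.2) _ g).symm
      _ = 0 := by
          rw [finsum_levelCosets h𝔪 fun e => Φ e g]
          exact (hΦ.2.1 g).source _
  · funext g
    calc degT 𝔭 𝔪 α (Φ (stdEdge 𝔭)) g
        = ∑ᶠ x : LevelCosets 𝔭 𝔪,
            Φ (localGL 𝔭 (α⁻¹ * x.out.1 * α) • stdEdge 𝔭) (g.1, g.2 * toPGL α) :=
          finsum_congr fun x => by
            -- The base point is `gα` because `gα · α⁻¹γ_iα = gγ_iα`, the argument in `φ_t`.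
            rw [treeForms_smul hΦ (conj_mem_Omega hα x.out.2)]
            simp [mul_assoc]
      _ = 0 := by
          rw [finsum_levelCosets_symm h𝔪 hα fun e => Φ e (g.1, g.2 * toPGL α)]
          exact (hΦ.2.1 _).target _

/-- Injectivity: equivariance propagates the vanishing to the orbit of `e_*`, alternation to the
reversed edges. -/
theorem treeForms_eq_zero (hα : IsAtkinLehner 𝔭 α) (hΦ : Φ ∈ treeForms σ p 𝔭 𝔪 k)
    (h0 : Φ (stdEdge 𝔭) = 0) : Φ = 0 := by
  funext e g
  obtain ⟨γ, hγ, h | h⟩ := exists_mem_Omega_smul_stdEdge (p := p) (𝔪 := 𝔪) hα e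
  · rw [← h, treeForms_smul hΦ hγ, h0]
    rfl
  · have h1 := (hΦ.2.1 g).symm e
    rw [← h, treeForms_smul hΦ hγ, h0] at h1
    exact neg_eq_zero.1 h1.symm

end Restriction

/-! ### Extension of newforms to the tree -/

section Extension

variable {F : Type*} [Field F] [NumberField F] {σ : F →+* ℂ} {p : ℕ} {k : ℕ}
  {𝔭 : HeightOneSpectrum (𝓞 F)} {𝔪 : Ideal (𝓞 F)} {α : GL2Fin F} {f : PGL2f F → WeightSpace k}

open Classical in
/-- The extension of a function on `PGL₂^f(𝔸_F)` to an `Ω`-equivariant alternating function on the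
edges of the tree. -/
def treeExtension (p : ℕ) (𝔭 : HeightOneSpectrum (𝓞 F)) (𝔪 : Ideal (𝓞 F))
    (f : PGL2f F → WeightSpace k) (e : Edge 𝔭) (g : PGL2f F) : WeightSpace k :=
  if h : ∃ γ, toPGL γ ∈ Omega p 𝔭 𝔪 ∧ localGL 𝔭 γ • stdEdge 𝔭 = e then
    f (g.1, g.2 * toPGL h.choose)
  else if h : ∃ γ, toPGL γ ∈ Omega p 𝔭 𝔪 ∧ localGL 𝔭 γ • stdEdge 𝔭 = e.symm then
    -f (g.1, g.2 * toPGL h.choose)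
  -- Never reached once an Atkin–Lehner element exists, by `exists_mem_Omega_smul_stdEdge`.
  else 0

/-- The extension does not depend on the chosen `γ`: `δ⁻¹γ` stabilizes `e_*`, so modulo the centre
it lies in `Ω₀(𝔭𝔪)`, under which `f` is invariant. -/
theorem cuspFormsPGL_eq_of_smul_eq (h𝔪 : IsCoprime 𝔭.asIdeal 𝔪)
    (hf : f ∈ cuspFormsPGL σ k (Omega0 (𝔭.asIdeal * 𝔪))) {γ δ : GL2Fin F}
    (hγ : toPGL γ ∈ Omega p 𝔭 𝔪) (hδ : toPGL δ ∈ Omega p 𝔭 𝔪)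
    (h : localGL 𝔭 γ • stdEdge 𝔭 = localGL 𝔭 δ • stdEdge 𝔭) (g : PGL2f F) :
    f (g.1, g.2 * toPGL γ) = f (g.1, g.2 * toPGL δ) := by
  obtain ⟨u, hu, hu'⟩ := exists_mem_Omega0_mul_of_smul_stdEdge (p := p) (γ := δ⁻¹ * γ) h𝔪
    (by rw [map_mul, map_inv]; exact mul_mem (inv_mem hδ) hγ)
    (by rw [map_mul, map_inv, mul_smul, h, inv_smul_smul])
  have := cuspFormsPGL_level hf hu (g.1, g.2 * toPGL δ)
  rwa [hu', map_mul, map_inv, mul_assoc, mul_inv_cancel_left] at this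

theorem treeExtension_of_smul_eq (h𝔪 : IsCoprime 𝔭.asIdeal 𝔪)
    (hf : f ∈ cuspFormsPGL σ k (Omega0 (𝔭.asIdeal * 𝔪))) {γ : GL2Fin F}
    (hγ : toPGL γ ∈ Omega p 𝔭 𝔪) {e : Edge 𝔭} (h : localGL 𝔭 γ • stdEdge 𝔭 = e) (g : PGL2f F) :
    treeExtension p 𝔭 𝔪 f e g = f (g.1, g.2 * toPGL γ) := by
  have hex : ∃ γ, toPGL γ ∈ Omega p 𝔭 𝔪 ∧ localGL 𝔭 γ • stdEdge 𝔭 = e := ⟨γ, hγ, h⟩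
  rw [treeExtension, dif_pos hex]
  exact cuspFormsPGL_eq_of_smul_eq h𝔪 hf hex.choose_spec.1 hγ (hex.choose_spec.2.trans h.symm) g

theorem treeExtension_of_smul_eq_symm (h𝔭 : (p : 𝓞 F) ∈ 𝔭.asIdeal) (h𝔪 : IsCoprime 𝔭.asIdeal 𝔪)
    (hf : f ∈ cuspFormsPGL σ k (Omega0 (𝔭.asIdeal * 𝔪))) {γ : GL2Fin F}
    (hγ : toPGL γ ∈ Omega p 𝔭 𝔪) {e : Edge 𝔭} (h : localGL 𝔭 γ • stdEdge 𝔭 = e.symm)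
    (g : PGL2f F) : treeExtension p 𝔭 𝔪 f e g = -f (g.1, g.2 * toPGL γ) := by
  have hex : ∃ γ, toPGL γ ∈ Omega p 𝔭 𝔪 ∧ localGL 𝔭 γ • stdEdge 𝔭 = e.symm := ⟨γ, hγ, h⟩
  have hnex : ¬ ∃ γ, toPGL γ ∈ Omega p 𝔭 𝔪 ∧ localGL 𝔭 γ • stdEdge 𝔭 = e := by
    rintro ⟨δ, hδ, rfl⟩
    refine smul_stdEdge_ne_symm (p := p) (𝔪 := 𝔪) (γ := δ⁻¹ * γ) h𝔭 ?_ ?_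
    · rw [map_mul, map_inv]
      exact mul_mem (inv_mem hδ) hγ
    · rw [map_mul, map_inv, mul_smul, h, ← smul_symm, inv_smul_smul]
  rw [treeExtension, dif_neg hnex, dif_pos hex,
    cuspFormsPGL_eq_of_smul_eq h𝔪 hf hex.choose_spec.1 hγ (hex.choose_spec.2.trans h.symm) g]

theorem treeExtension_stdEdge (h𝔪 : IsCoprime 𝔭.asIdeal 𝔪)
    (hf : f ∈ cuspFormsPGL σ k (Omega0 (𝔭.asIdeal * 𝔪))) :
    treeExtension p 𝔭 𝔪 f (stdEdge 𝔭) = f := by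
  funext g
  rw [treeExtension_of_smul_eq (γ := 1) h𝔪 hf (by rw [map_one]; exact one_mem _)
    (by rw [map_one, one_smul]), map_one, mul_one]

theorem treeExtension_symm (h𝔭 : (p : 𝓞 F) ∈ 𝔭.asIdeal) (h𝔪 : IsCoprime 𝔭.asIdeal 𝔪)
    (hα : IsAtkinLehner 𝔭 α) (hf : f ∈ cuspFormsPGL σ k (Omega0 (𝔭.asIdeal * 𝔪))) (e : Edge 𝔭)
    (g : PGL2f F) : treeExtension p 𝔭 𝔪 f e.symm g = -treeExtension p 𝔭 𝔪 f e g := by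
  obtain ⟨γ, hγ, h | h⟩ := exists_mem_Omega_smul_stdEdge (p := p) (𝔪 := 𝔪) hα e
  · rw [treeExtension_of_smul_eq h𝔪 hf hγ h,
      treeExtension_of_smul_eq_symm h𝔭 h𝔪 hf hγ (by rw [h, SimpleGraph.Dart.symm_symm])]
  · rw [treeExtension_of_smul_eq h𝔪 hf hγ h, treeExtension_of_smul_eq_symm h𝔭 h𝔪 hf hγ h, neg_neg]

theorem treeExtension_smul (h𝔭 : (p : 𝓞 F) ∈ 𝔭.asIdeal) (h𝔪 : IsCoprime 𝔭.asIdeal 𝔪)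
    (hα : IsAtkinLehner 𝔭 α) (hf : f ∈ cuspFormsPGL σ k (Omega0 (𝔭.asIdeal * 𝔪)))
    {δ : GL2Fin F} (hδ : toPGL δ ∈ Omega p 𝔭 𝔪) (e : Edge 𝔭) (g : PGL2f F) :
    treeExtension p 𝔭 𝔪 f (localGL 𝔭 δ • e) g
      = treeExtension p 𝔭 𝔪 f e (g.1, g.2 * toPGL δ) := by
  obtain ⟨γ, hγ, h⟩ := exists_mem_Omega_smul_stdEdge (p := p) (𝔪 := 𝔪) hα e
  have hδγ : toPGL (δ * γ) ∈ Omega p 𝔭 𝔪 := by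
    rw [map_mul]
    exact mul_mem hδ hγ
  rcases h with h | h
  · rw [treeExtension_of_smul_eq h𝔪 hf hγ h,
      treeExtension_of_smul_eq h𝔪 hf hδγ (by rw [map_mul, mul_smul, h]), map_mul, mul_assoc]
  · rw [treeExtension_of_smul_eq_symm h𝔭 h𝔪 hf hγ h,
      treeExtension_of_smul_eq_symm h𝔭 h𝔪 hf hδγ (by rw [map_mul, mul_smul, h, smul_symm]),
      map_mul, mul_assoc]

/-- Every vertex is `Ω`-equivalent to an end of `e_*`, and equivariance turns the sum there into one
at an end of `e_*`, for another `g`. This is why the two sums are shown to vanish for all `g` before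
passing to a general vertex. -/
theorem treeExtension_isHarmonic (h𝔭 : (p : 𝓞 F) ∈ 𝔭.asIdeal) (h𝔪 : IsCoprime 𝔭.asIdeal 𝔪)
    (hα : IsAtkinLehner 𝔭 α) (hf : f ∈ newForms σ 𝔭 𝔪 h𝔪 α k) (g : PGL2f F) :
    IsHarmonic fun e => treeExtension p 𝔭 𝔪 f e g := by
  obtain ⟨hf, hs, ht⟩ := hf
  have hswap : ∀ (v : Vertex 𝔭) (g : PGL2f F),
      ∑ᶠ e ∈ {e : Edge 𝔭 | e.snd = v}, treeExtension p 𝔭 𝔪 f e g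
        = -∑ᶠ e ∈ {e : Edge 𝔭 | e.fst = v}, treeExtension p 𝔭 𝔪 f e g := by
    intro v g
    rw [finsum_snd_eq, ← finsum_mem_neg_distrib _ (finite_edges v)]
    exact finsum_congr fun e => by rw [treeExtension_symm h𝔭 h𝔪 hα hf]
  have hsrc : ∀ g : PGL2f F, ∑ᶠ e ∈ {e : Edge 𝔭 | e.fst = (stdLattice 𝔭).toVertex},
      treeExtension p 𝔭 𝔪 f e g = 0 := by
    intro g
    rw [← finsum_levelCosets h𝔪 fun e => treeExtension p 𝔭 𝔪 f e g]
    refine Eq.trans (finsum_congr fun x => ?_) (congrFun hs g)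
    exact treeExtension_of_smul_eq h𝔪 hf (toPGL_mem_Omega_of_mem_Omega0 x.out.2) rfl g
  have htgt : ∀ g : PGL2f F, ∑ᶠ e ∈ {e : Edge 𝔭 | e.snd = (stdLattice' 𝔭).toVertex},
      treeExtension p 𝔭 𝔪 f e g = 0 := by
    intro g
    rw [← finsum_levelCosets_symm h𝔪 hα fun e => treeExtension p 𝔭 𝔪 f e g]
    -- The identity for `φ_t` is used at `gα⁻¹`, since `gα⁻¹ · γ_iα = g · α⁻¹γ_iα`.
    refine Eq.trans (finsum_congr fun x => ?_) (congrFun ht (g.1, g.2 * (toPGL α)⁻¹))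
    rw [treeExtension_of_smul_eq h𝔪 hf (conj_mem_Omega hα x.out.2) rfl g]
    simp [mul_assoc]
  have hall : ∀ (v : Vertex 𝔭) (g : PGL2f F),
      ∑ᶠ e ∈ {e : Edge 𝔭 | e.fst = v}, treeExtension p 𝔭 𝔪 f e g = 0 := by
    intro v g
    obtain ⟨γ, hγ, rfl | rfl⟩ := exists_mem_Omega_smul_vertex (p := p) (𝔪 := 𝔪) hα v
    · rw [finsum_fst_smul]
      simp only [treeExtension_smul h𝔭 h𝔪 hα hf hγ]
      exact hsrc _
    · rw [finsum_fst_smul]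
      simp only [treeExtension_smul h𝔭 h𝔪 hα hf hγ]
      exact neg_eq_zero.1 ((hswap _ _).symm.trans (htgt _))
  exact ⟨fun e => treeExtension_symm h𝔭 h𝔪 hα hf e g, fun v => hall v g,
    fun v => by rw [hswap, hall, neg_zero]⟩

theorem treeExtension_mem_treeForms (h𝔭 : (p : 𝓞 F) ∈ 𝔭.asIdeal) (h𝔪 : IsCoprime 𝔭.asIdeal 𝔪)
    (hα : IsAtkinLehner 𝔭 α) (hf : f ∈ newForms σ 𝔭 𝔪 h𝔪 α k) :
    treeExtension p 𝔭 𝔪 f ∈ treeForms σ p 𝔭 𝔪 k := by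
  have hf1 := hf.1
  refine ⟨fun γ hγ e g => ?_, treeExtension_isHarmonic h𝔭 h𝔪 hα hf, fun e => ?_⟩
  · rw [treeExtension_smul h𝔭 h𝔪 hα hf1 hγ, inv_mul_cancel_right]
  obtain ⟨γ, hγ, h⟩ := exists_mem_Omega_smul_stdEdge (p := p) (𝔪 := 𝔪) hα e
  have key : (fun g : PGL2f F => f (g.1, g.2 * toPGL γ))
      ∈ cuspFormsPGL σ k (edgeStabilizer p 𝔭 𝔪 e) := by
    have hpull : IsCuspForm σ k (edgeStabilizer p 𝔭 𝔪 e)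
        fun g : GL2Adele F => f (g.1, toPGL (g.2 * γ)) := by
      refine IsCuspForm.translate (mem_cuspFormsPGL.1 hf1) γ fun g u hu => ?_
      have hu2 : localGL 𝔭 u • e = e := hu.2
      -- If `u` fixes `e`, it also fixes its reverse, so `uγ` and `γ` carry `e_*` to the same edge
      -- in either case.
      have h1 := cuspFormsPGL_eq_of_smul_eq h𝔪 hf1 (γ := u * γ) (δ := γ) (p := p)
        (by rw [map_mul]; exact mul_mem hu.1 hγ) hγ (by
          rw [map_mul, mul_smul]
          rcases h with h | h <;> rw [h]
          · exact hu2
          · rw [smul_symm, hu2]) (g.1, toPGL g.2)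
      simpa only [map_mul, mul_assoc] using h1
    simp only [map_mul] at hpull
    exact hpull
  rcases h with h | h
  · have he : treeExtension p 𝔭 𝔪 f e = fun g : PGL2f F => f (g.1, g.2 * toPGL γ) :=
      funext fun g => treeExtension_of_smul_eq h𝔪 hf1 hγ h g
    rw [he]
    exact key
  · have he : treeExtension p 𝔭 𝔪 f e = -fun g : PGL2f F => f (g.1, g.2 * toPGL γ) :=
      funext fun g => treeExtension_of_smul_eq_symm h𝔭 h𝔪 hf1 hγ h g
    rw [he]
    exact neg_mem key

end Extension

/-! ### Class number one -/

section ClassNumberOne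

variable {F : Type*} [Field F] [NumberField F]

/-- If `F` has class number one, every finite idele is a principal idele times a unit. -/
theorem exists_valued_eq [IsPrincipalIdealRing (𝓞 F)] (z : (FinAdeles F)ˣ) :
    ∃ a : Fˣ, ∀ v : HeightOneSpectrum (𝓞 F),
      Valued.v ((a : F) : v.adicCompletion F) = Valued.v (localComp v z.1) := by
  classical
  obtain ⟨hz, hfin⟩ := FiniteAdeleRing.isUnit_iff.1 z.isUnit
  have hgen : ∀ v : HeightOneSpectrum (𝓞 F), ∃ a : 𝓞 F, v.asIdeal = Ideal.span {a} :=
    fun v => (IsPrincipalIdealRing.principal v.asIdeal).principal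
  choose a ha using hgen
  have ha0 : ∀ v, a v ≠ 0 := by
    intro v h
    have := ha v
    rw [h, Ideal.span_singleton_eq_bot.2 rfl] at this
    exact v.ne_bot this
  have hself : ∀ v : HeightOneSpectrum (𝓞 F),
      v.valuation F (algebraMap (𝓞 F) F (a v)) = WithZero.exp (-1 : ℤ) := by
    intro v
    rw [HeightOneSpectrum.valuation_of_algebraMap, v.intValuation_singleton (ha0 v) (ha v)]
  have hne : ∀ v w : HeightOneSpectrum (𝓞 F), v ≠ w →
      w.valuation F (algebraMap (𝓞 F) F (a v)) = 1 := by
    intro v w hvw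
    refine w.valuation_eq_one_iff_notMem.2 fun h => hvw ?_
    have hle : v.asIdeal ≤ w.asIdeal := by
      rw [ha v, Ideal.span_singleton_le_iff_mem]
      exact h
    exact HeightOneSpectrum.ext (v.isMaximal.eq_of_le w.isPrime.ne_top hle)
  -- The element sought is a product of powers of generators of the primes where `z` is not a unit.
  -- The exponents carry a minus sign because each generator has value `exp (-1)` at its own prime.
  let S : Finset (HeightOneSpectrum (𝓞 F)) := (Filter.eventually_cofinite.1 hfin).toFinset
  let n : HeightOneSpectrum (𝓞 F) → ℤ := fun v => -WithZero.log (Valued.v (localComp v z.1))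
  have hA : ∏ v ∈ S, (algebraMap (𝓞 F) F (a v)) ^ n v ≠ 0 := by
    refine Finset.prod_ne_zero_iff.2 fun v _ => zpow_ne_zero _ ?_
    simpa using ha0 v
  refine ⟨Units.mk0 _ hA, fun w => ?_⟩
  have hw0 : Valued.v (localComp w z.1) ≠ 0 := (Valuation.ne_zero_iff _).2 (hz w)
  rw [HeightOneSpectrum.valuedAdicCompletion_eq_valuation', Units.val_mk0, map_prod]
  simp only [map_zpow₀]
  by_cases hw : w ∈ S
  · rw [Finset.prod_eq_single_of_mem w hw fun v _ hv => by rw [hne v w hv, _root_.one_zpow], hself,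
      ← WithZero.exp_zsmul]
    conv_rhs => rw [← WithZero.exp_log hw0]
    congr 1
    simp [n]
  · rw [Finset.prod_eq_one fun v hv => by
      rw [hne v w (fun h => hw (h ▸ hv)), _root_.one_zpow]]
    by_contra hcon
    exact hw (by
      rw [Set.Finite.mem_toFinset]
      exact fun h => hcon h.symm)

theorem subst_one (P : MvPolynomial (Fin 2) ℂ) : subst 1 P = P := by
  have h : (fun i : Fin 2 => ∑ j, MvPolynomial.C ((1 : Matrix (Fin 2) (Fin 2) ℂ) i j) *
      MvPolynomial.X j) = (MvPolynomial.X : Fin 2 → MvPolynomial (Fin 2) ℂ) := by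
    funext i
    simp [Matrix.one_apply]
  rw [subst, h, MvPolynomial.bind₁_X_left]
  rfl

theorem scalar_mem_Omega0 (𝔫 : Ideal (𝓞 F)) {u : (FinAdeles F)ˣ}
    (h : ∀ v, Valued.v (localComp v u.1) = 1) :
    GeneralLinearGroup.scalar (Fin 2) u ∈ Omega0 𝔫 := by
  have key : ∀ (w : (FinAdeles F)ˣ) (v : HeightOneSpectrum (𝓞 F)),
      Valued.v (localComp v w.1) = 1 →
      (localGL v (GeneralLinearGroup.scalar (Fin 2) w)).1 ∈ localOrder 𝔫 v := by
    intro w v hw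
    rw [localGL_scalar]
    refine ⟨fun i j => ?_, 0, Ideal.zero_mem _, by simp⟩
    rw [HeightOneSpectrum.mem_adicCompletionIntegers]
    fin_cases i <;> fin_cases j <;> simp [hw]
  refine fun v _ => ⟨key u v (h v), ?_⟩
  rw [← map_inv]
  refine key u⁻¹ v ?_
  have h1 : localComp v u.1 * localComp v (u⁻¹).1 = 1 := by
    rw [← map_mul, Units.mul_inv, map_one]
  have h2 := congrArg Valued.v h1
  rwa [map_mul, h v, one_mul, map_one] at h2

/-- With `z = b u`, `b` principal and `u` a unit at all places, the scalar `u` lies in `Ω₀(𝔫)`.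
Automorphy trades `b` for the inverse scalar at infinity, which acts trivially by the weight
condition. -/
theorem IsCuspForm.mul_scalar [IsPrincipalIdealRing (𝓞 F)] {σ : F →+* ℂ} {k : ℕ}
    {𝔫 : Ideal (𝓞 F)} {f : GL2Adele F → WeightSpace k} (hf : IsCuspForm σ k (Omega0 𝔫) f)
    (z : (FinAdeles F)ˣ) (g : GL2Adele F) :
    f (g.1, g.2 * GeneralLinearGroup.scalar (Fin 2) z) = f g := by
  obtain ⟨a, ha⟩ := exists_valued_eq z
  let b : (FinAdeles F)ˣ := Units.map (algebraMap F (FinAdeles F)).toMonoidHom a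
  have hb : GeneralLinearGroup.map (algebraMap F (FinAdeles F))
      (GeneralLinearGroup.scalar (Fin 2) a) = GeneralLinearGroup.scalar (Fin 2) b :=
    GeneralLinearGroup.map_scalar _ _
  have hu : GeneralLinearGroup.scalar (Fin 2) (b⁻¹ * z) ∈ Omega0 𝔫 := by
    refine scalar_mem_Omega0 𝔫 fun v => ?_
    have h1 : localComp v b.1 * localComp v (b⁻¹ * z).1 = localComp v z.1 := by
      rw [← map_mul, ← Units.val_mul, mul_inv_cancel_left]
    have h2 := congrArg Valued.v h1
    rw [map_mul, ← ha v] at h2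
    have h3 : Valued.v (localComp v b.1) = Valued.v ((a : F) : v.adicCompletion F) := rfl
    rw [h3] at h2
    refine mul_left_cancel₀ ?_ (h2.trans (mul_one _).symm)
    rw [HeightOneSpectrum.valuedAdicCompletion_eq_valuation']
    exact (Valuation.ne_zero_iff _).2 a.ne_zero
  have hz : GeneralLinearGroup.scalar (Fin 2) z = GeneralLinearGroup.scalar (Fin 2) b *
      GeneralLinearGroup.scalar (Fin 2) (b⁻¹ * z) := by
    rw [← map_mul, mul_inv_cancel_left]
  let c : ℂˣ := Units.map σ.toMonoidHom a
  have hc : GeneralLinearGroup.map σ (GeneralLinearGroup.scalar (Fin 2) a)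
      = GeneralLinearGroup.scalar (Fin 2) c := GeneralLinearGroup.map_scalar _ _
  rw [hz, ← mul_assoc]
  refine (hf.level (g.1, g.2 * GeneralLinearGroup.scalar (Fin 2) b) _ hu).trans ?_
  rw [← GeneralLinearGroup.scalar_commute, ← hb]
  -- The infinite component is multiplied by `c⁻¹` beforehand, so that the archimedean image of `a`
  -- cancels it.
  have h1 := hf.automorphic (GeneralLinearGroup.scalar (Fin 2) a)
    (GeneralLinearGroup.scalar (Fin 2) c⁻¹ * g.1, g.2)
  rw [hc, ← mul_assoc, ← map_mul, mul_inv_cancel, map_one, one_mul] at h1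
  rw [h1]
  have h2 := hf.weight g c⁻¹ 1 (one_mem _)
  rw [mul_one, Units.val_one, subst_one] at h2
  exact Subtype.ext h2

/-- A form is descended along an arbitrary section of `toPGL`; the choice is harmless since two
lifts differ by a scalar, under which the form is invariant. -/
theorem map_pullback_cuspFormsPGL [IsPrincipalIdealRing (𝓞 F)] (σ : F →+* ℂ) (k : ℕ)
    (𝔫 : Ideal (𝓞 F)) :
    (cuspFormsPGL σ k (Omega0 𝔫)).map (pullback k) = cuspForms σ k (Omega0 𝔫) := by
  refine le_antisymm (Submodule.map_comap_le _ _) fun f hf => ?_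
  let φ : PGL2f F → WeightSpace k := fun g => f (g.1, Function.surjInv toPGL_surjective g.2)
  have hpull : pullback k φ = f := by
    funext g
    change f (g.1, Function.surjInv toPGL_surjective (toPGL g.2)) = f g
    obtain ⟨z, hz, hg⟩ := toPGL_eq_iff.1 (Function.surjInv_eq toPGL_surjective (toPGL g.2)).symm
    rw [GeneralLinearGroup.center_eq_range_scalar] at hz
    obtain ⟨z, rfl⟩ := hz
    rw [hg]
    exact IsCuspForm.mul_scalar hf z g
  refine ⟨φ, ?_, hpull⟩
  change pullback k φ ∈ cuspForms σ k (Omega0 𝔫)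
  rwa [hpull]

end ClassNumberOne

end

end BianchiTree

/-! ### The isomorphism between forms on the tree and `𝔭`-new forms. -/

theorem mainTheorem5 {F : Type*} [Field F] [NumberField F] [Algebra.IsQuadraticExtension ℚ F]
    [IsTotallyComplex F] (σ : F →+* ℂ) (p : ℕ) (hp : p.Prime)
    (𝔭 : HeightOneSpectrum (𝓞 F)) (h𝔭 : (p : 𝓞 F) ∈ 𝔭.asIdeal)
    (𝔪 : Ideal (𝓞 F)) (h𝔪 : IsCoprime 𝔭.asIdeal 𝔪) (k : ℕ)
    (α : GL2Fin F) (hα : IsAtkinLehner 𝔭 α) :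
    (∃ Φ : treeForms σ p 𝔭 𝔪 k ≃ₗ[ℂ] newForms σ 𝔭 𝔪 h𝔪 α k,
      ∀ 𝓕 : treeForms σ p 𝔭 𝔪 k, (Φ 𝓕).1 = 𝓕.1 (stdEdge 𝔭)) ∧
    (∀ f ∈ cuspFormsPGL σ k (Omega0 (𝔭.asIdeal * 𝔪)),
      (∃ 𝓕 ∈ treeForms σ p 𝔭 𝔪 k, 𝓕 (stdEdge 𝔭) = f) ↔ f ∈ newForms σ 𝔭 𝔪 h𝔪 α k) ∧
    (IsPrincipalIdealRing (𝓞 F) →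
      (cuspFormsPGL σ k (Omega0 (𝔭.asIdeal * 𝔪))).map (pullback k)
        = cuspForms σ k (Omega0 (𝔭.asIdeal * 𝔪))) := by
  refine ⟨?_, fun f _ => ⟨?_, fun hf => ?_⟩, fun _ => map_pullback_cuspFormsPGL σ k _⟩
  · let L : treeForms σ p 𝔭 𝔪 k →ₗ[ℂ] newForms σ 𝔭 𝔪 h𝔪 α k :=
      { toFun := fun 𝓕 => ⟨𝓕.1 (stdEdge 𝔭), treeForms_stdEdge_mem_newForms h𝔪 hα 𝓕.2⟩
        map_add' := fun _ _ => rfl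
        map_smul' := fun _ _ => rfl }
    refine ⟨LinearEquiv.ofBijective L ⟨?_, fun f => ?_⟩, fun _ => rfl⟩
    · rw [injective_iff_map_eq_zero]
      exact fun 𝓕 h => Subtype.ext (treeForms_eq_zero hα 𝓕.2 (congrArg Subtype.val h))
    · exact ⟨⟨_, treeExtension_mem_treeForms h𝔭 h𝔪 hα f.2⟩,
        Subtype.ext (treeExtension_stdEdge h𝔪 f.2.1)⟩
  · rintro ⟨𝓕, h𝓕, rfl⟩
    exact treeForms_stdEdge_mem_newForms h𝔪 hα h𝓕
  · exact ⟨_, treeExtension_mem_treeForms h𝔭 h𝔪 hα hf, treeExtension_stdEdge h𝔪 hf.1⟩
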